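/- **Conventions.** All digraphs are finite. A digraph is connected if its underlying undirected graph is; a cut-vertex is a vertex whose removal disconnects it; a block is a maximal connected subgraph without cut-vertex. For $n,r,m_1,\dots,m_r\ge 1$, $dC(n;m_1,\dots,m_r)$ is the digraph with vertices $u_0,\dots,u_n$ and $v^{(j)}_i$ ($1\le j\le r$, $1\le i\le m_j$), formed by the directed paths $u_0\to u_1\to\cdots\to u_n$ and $u_n=v^{(j)}_0\to v^{(j)}_1\to\cdots\to v^{(j)}_{m_j}\to v^{(j)}_{m_j+1}=u_0$, $1\le j\le r$. A digraph is of cactoid type if it is non-empty, strongly connected, and each of its blocks is isomorphic to some $dC(n;m_1,\dots,m_r)$. For a digraph $G=(V,E)$ with weights $W:E\to\mathbb R$, the entry $d_{xy}$ of the distance matrix is the minimum total weight of a directed path (without repeated vertices) from $x$ to $y$; in particular $d_{xx}=0$. $\operatorname{cof}A$ is the sum of all cofactors of $A$, $\mathbf 1$ is the all-ones column vector, and a square matrix $\mathcal L$ is Laplacian-like if $\mathcal L\mathbf 1=0$ and $\mathbf 1^T\mathcal L=0$. **Block data.** Let a weighted digraph be identified with $dC(n;m_1,\dots,m_r)$.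 Let $W_i$ be the weight of $u_{i-1}\to u_i$ ($1\le i\le n$), $W^{(j)}_i$ the weight of $v^{(j)}_{i-1}\to v^{(j)}_i$ ($1\le i\le m_j$), and $W^{(j)}_0$ the weight of $v^{(j)}_{m_j}\to u_0$. Put $w_c=\sum_{i=1}^n W_i$, $\widehat w_j=\sum_{i=0}^{m_j}W^{(j)}_i$, $w_j=w_c+\widehat w_j$, $w_c^{(2)}=\sum_{1\le s<t\le n}W_sW_t$, $w_j^{(2)}=\sum_{0\le s<t\le m_j}W^{(j)}_sW^{(j)}_t$, and number the cycles such that $w_1\le\cdots\le w_r$. When all $w_j\neq0$, define $$\lambda=\frac{w_c\widehat w_1}{w_1}+\frac{w_c^{(2)}}{w_1}+\sum_{j=1}^r\frac{w_j^{(2)}}{w_j},$$ $$\alpha(u_0)=\sum_{j=1}^r\frac{W^{(j)}_0}{w_j}-\sum_{j=2}^r\frac{\widehat w_j}{w_j},\quad \alpha(u_i)=\frac{W_i}{w_1}\ (1\le i\le n),\quad \alpha(v^{(j)}_i)=\frac{W^{(j)}_i}{w_j},$$ $$\beta(u_i)=\frac{W_{i+1}}{w_1}\ (0\le i<n),\quad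 \beta(u_n)=\sum_{j=1}^r\frac{W^{(j)}_1}{w_j}-\sum_{j=2}^r\frac{\widehat w_j}{w_j},\quad \beta(v^{(j)}_i)=\frac{W^{(j)}_{i+1}}{w_j}\ (1\le i<m_j),\quad \beta(v^{(j)}_{m_j})=\frac{W^{(j)}_0}{w_j},$$ and $\mathcal L=\Delta-A+\widehat L$. Here $A_{xy}=1/w_1$ if $x\to y$ is an edge of the path $u_0\to\cdots\to u_n$, $A_{xy}=1/w_j$ if $x\to y$ is an edge of the $j$-th path from $u_n$ to $u_0$, and $A_{xy}=0$ otherwise; $\Delta$ is the diagonal matrix of row sums of $A$; and $\widehat L_{u_nu_0}=\sum_{j=2}^r 1/w_j$, $\widehat L_{u_nu_n}=-\sum_{j=2}^r1/w_j$, all other entries of $\widehat L$ being $0$. **Theorem.** Let $G=(V,E)$ be a cactoid-type digraph with blocks $G_t=(V_t,E_t)$, $1\le t\le b$, and let $W:E\to\mathbb R$ be a weight function. Let $D$ and $D_t$ be the distance matrices of the weighted digraphs $G^W$ and $G_t^W$. Suppose that $\det D\ne0$ and that $\det D_t\neq 0$ and $\operatorname{cof}D_t\neq0$ for all $t$. Then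 each block $G_t$ can be identified with some $dC(n;m_1,\dots,m_r)$ with $w_1\le\cdots\le w_r$, and for every choice of such identifications, with block data $\lambda_t,\alpha_t,\beta_t,\mathcal L_t$ as above, we have $\lambda_t=\det D_t/\operatorname{cof}D_t$, and the number $\lambda$, column vectors $\alpha,\beta$ and matrix $\mathcal L$ given by $$\lambda=\sum_{t=1}^b\lambda_t,\quad \alpha(v)=\sum_{t:\,v\in V_t}\alpha_t(v)-(\mathrm{bi}(v)-1),\quad \beta(v)=\sum_{t:\,v\in V_t}\beta_t(v)-(\mathrm{bi}(v)-1),\quad \mathcal L=\sum_{t=1}^b\widehat{\mathcal L}_t,$$ where $\mathrm{bi}(v)$ is the number of blocks containing $v$ and $\widehat{\mathcal L}_t$ is $\mathcal L_t$ extended by zeros to $V\times V$, satisfy: $\mathcal L$ is Laplacian-like, $\lambda\ne0$, and $$D^{-1}=-\mathcal L+\frac1\lambda\,\beta\alpha^T .$$ -/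

import Mathlib

open scoped Matrix

namespace CactoidType

/-! ### Digraphs, blocks -/

/-- A digraph is strongly connected if it has a vertex and every vertex can be reached from every
vertex along directed edges. -/
def StronglyConnected {V : Type*} (G : Digraph V) : Prop :=
  Nonempty V ∧ ∀ x y : V, Relation.ReflTransGen G.Adj x y

/-- The subdigraph of `G` induced on a set of vertices. -/
def induce {V : Type*} (G : Digraph V) (S : Finset V) : Digraph S where
  Adj x y := G.Adj x y

/-- `v` is a cut-vertex if deleting it disconnects the digraph, where connectedness
ignores orientations. -/
def IsCutVertex {V : Type*} (G : Digraph V) (v : V) : Prop :=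
  ¬ (G.toSimpleGraphInclusive.induce {v}ᶜ).Preconnected

/-- A block is a maximal connected subgraph without cut-vertex. Such a maximal subgraph contains
all the edges of `G` between its vertices, so a block is given by its set of vertices. -/
def IsBlock {V : Type*} (G : Digraph V) (S : Finset V) : Prop :=
  Maximal (fun T : Finset V =>
    (induce G T).toSimpleGraphInclusive.Connected ∧ ∀ v, ¬ IsCutVertex (induce G T) v) S

/-- The type of (vertex sets of) blocks of `G`. -/
abbrev Block {V : Type*} (G : Digraph V) : Type _ := {S : Finset V // IsBlock G S}

noncomputable instance instFintypeBlock {V : Type*} [Fintype V] (G : Digraph V) :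
    Fintype (Block G) := Fintype.ofFinite _

/-- The number of blocks that contain the vertex `v`. -/
noncomputable def blockIndex {V : Type*} (G : Digraph V) (v : V) : ℕ :=
  Nat.card {t : Block G // v ∈ t.1}

/-! ### Distance matrix of a weighted digraph -/

/-- Total weight of the edges of the directed path listed as `x₀, x₁, …, x_k`. -/
def pathWeight {V : Type*} (W : V → V → ℝ) : List V → ℝ
  | x :: y :: l => W x y + pathWeight W (y :: l)
  | _ => 0

/-- `l` lists the vertices of a directed path (no repeated vertices) from `x` to `y`. -/
def IsDirectedPath {V : Type*} (G : Digraph V) (x y : V) (l : List V) : Prop :=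
  l.IsChain G.Adj ∧ l.Nodup ∧ l.head? = some x ∧ l.getLast? = some y

/-- The distance matrix of `(G, W)`: the `(x, y)` entry is the minimum total weight of a
directed path from `x` to `y`. The value `W x y` is the weight of the edge `x → y`; it is never
used if this is not an edge. -/
noncomputable def distMatrix {V : Type*} (G : Digraph V) (W : V → V → ℝ) : Matrix V V ℝ :=
  Matrix.of fun x y => sInf {c : ℝ | ∃ l, IsDirectedPath G x y l ∧ pathWeight W l = c}

/-- The distance matrix of a block, as a weighted digraph on its own. -/
noncomputable def blockDistMatrix {V : Type*} (G : Digraph V) (W : V → V → ℝ) (t : Block G) :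
    Matrix t.1 t.1 ℝ :=
  distMatrix (induce G t.1) fun x y => W x y

/-- The sum of all cofactors of `A` (the entries of the adjugate are the cofactors, transposed). -/
def cof {ι : Type*} [Fintype ι] [DecidableEq ι] (A : Matrix ι ι ℝ) : ℝ :=
  ∑ i, ∑ j, A.adjugate i j

/-! ### The digraph `dC(n; m₁, …, m_r)` -/

/-- Vertices: `inl i` is the vertex `u_i` of the common path, `0 ≤ i ≤ n`, and
`inr ⟨j, i⟩` is the vertex `v_{i+1}` of the `j`-th remaining path, `1 ≤ i + 1 ≤ m_j`. -/
abbrev DCVert (n : ℕ) {r : ℕ} (m : Fin r → ℕ) : Type := Fin (n + 1) ⊕ (Σ j : Fin r, Fin (m j))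

/-- The digraph consisting of `u_0 → u_1 → ⋯ → u_n` and, for every `j`,
`u_n → v_1^{(j)} → ⋯ → v_{m_j}^{(j)} → u_0` (intended for `n, r, m_j ≥ 1`). -/
def dC (n : ℕ) {r : ℕ} (m : Fin r → ℕ) : Digraph (DCVert n m) where
  Adj x y := match x, y with
    | .inl p, .inl q => q.val = p.val + 1
    | .inl p, .inr ⟨_, i⟩ => p.val = n ∧ i.val = 0
    | .inr ⟨j, i⟩, .inr ⟨l, k⟩ => j = l ∧ k.val = i.val + 1
    | .inr ⟨j, i⟩, .inl q => i.val + 1 = m j ∧ q.val = 0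

/-- An identification of a digraph `G` with some `dC(n; m₁, …, m_r)`, `n, r, m_j ≥ 1`. -/
structure DCPresentation {U : Type*} (G : Digraph U) where
  n : ℕ
  r : ℕ
  m : Fin r → ℕ
  one_le_n : 1 ≤ n
  one_le_r : 1 ≤ r
  one_le_m : ∀ j, 1 ≤ m j
  iso : (dC n m).Adj ≃r G.Adj

/-- Cactoid-type digraphs: strongly connected, and every block is some `dC(n; m₁, …, m_r)`. -/
def IsCactoidType {V : Type*} (G : Digraph V) : Prop :=
  StronglyConnected G ∧ ∀ t : Block G, Nonempty (DCPresentation (induce G t.1))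

/-! ### Laplacian-like matrices and the data `λ, α, β, 𝓛` -/

/-- All row sums and all column sums are zero. -/
def IsLaplacianLike {ι : Type*} [Fintype ι] (L : Matrix ι ι ℝ) : Prop :=
  L *ᵥ 1 = 0 ∧ 1 ᵥ* L = 0

/-- A number `λ`, two column vectors `α, β` and a square matrix `𝓛`. -/
structure LapData (ι : Type*) where
  lam : ℝ
  α : ι → ℝ
  β : ι → ℝ
  L : Matrix ι ι ℝ

/-- The sum of `f s * f t` over all `s < t`. -/
def pairSum {k : ℕ} (f : Fin k → ℝ) : ℝ :=
  ∑ p : Fin k × Fin k with p.1 < p.2, f p.1 * f p.2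

namespace DC

variable {n r : ℕ} {m : Fin r → ℕ} (W : DCVert n m → DCVert n m → ℝ)

/-- Weight of the edge `u_i → u_{i+1}`, `0 ≤ i < n`. -/
def commonWeight (i : Fin n) : ℝ := W (.inl i.castSucc) (.inl i.succ)

/-- The vertices `u_n = v_0, v_1, …, v_{m_j}, v_{m_j + 1} = u_0` of the `j`-th path. -/
def pathVertex (j : Fin r) : Fin (m j + 2) → DCVert n m :=
  Fin.cases (.inl (Fin.last n)) (Fin.lastCases (.inl 0) fun i => .inr ⟨j, i⟩)

/-- Weight of the edge `v_i → v_{i+1}`, `0 ≤ i ≤ m_j`, of the `j`-th path. -/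
def ownWeight (j : Fin r) (i : Fin (m j + 1)) : ℝ :=
  W (pathVertex j i.castSucc) (pathVertex j i.succ)

/-- Total weight of the common path. -/
def wc : ℝ := ∑ i, commonWeight W i

/-- Total weight of the `j`-th path from `u_n` to `u_0`. -/
def wHat (j : Fin r) : ℝ := ∑ i, ownWeight W j i

/-- Total weight of the `j`-th cycle. -/
def w (j : Fin r) : ℝ := wc W + wHat W j

variable (j₁ : Fin r)

/-- The number `λ`; here and below `j₁` stands for the first index. -/
noncomputable def lam : ℝ :=
  wc W * wHat W j₁ / w W j₁ + pairSum (commonWeight W) / w W j₁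
    + ∑ j, pairSum (ownWeight W j) / w W j

/-- The vector `α`. -/
noncomputable def alpha : DCVert n m → ℝ
  | .inl i => Fin.cases (motive := fun _ => ℝ)
      (∑ j, ownWeight W j (Fin.last (m j)) / w W j
        - ∑ j ∈ Finset.univ.erase j₁, wHat W j / w W j)
      (fun i => commonWeight W i / w W j₁) i
  | .inr ⟨j, i⟩ => ownWeight W j i.castSucc / w W j

/-- The vector `β`. -/
noncomputable def beta : DCVert n m → ℝ
  | .inl i => Fin.lastCases (motive := fun _ => ℝ)
      (∑ j, ownWeight W j 0 / w W j - ∑ j ∈ Finset.univ.erase j₁, wHat W j / w W j)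
      (fun i => commonWeight W i / w W j₁) i
  | .inr ⟨j, i⟩ => ownWeight W j i.succ / w W j

open Classical in
/-- The adjacency matrix in which the edges of the common path have weight `1 / w_1`
and the edges of the `j`-th path have weight `1 / w_j`. -/
noncomputable def adj : Matrix (DCVert n m) (DCVert n m) ℝ := Matrix.of fun x y =>
  if (dC n m).Adj x y then
    match x, y with
    | .inl _, .inl _ => 1 / w W j₁
    | .inl _, .inr ⟨j, _⟩ => 1 / w W j
    | .inr ⟨j, _⟩, _ => 1 / w W j
  else 0

/-- The perturbation of the Laplacian matrix. -/
noncomputable def perturbation : Matrix (DCVert n m) (DCVert n m) ℝ := Matrix.of fun x y =>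
  if x = .inl (Fin.last n) ∧ y = .inl 0 then ∑ j ∈ Finset.univ.erase j₁, 1 / w W j
  else if x = .inl (Fin.last n) ∧ y = .inl (Fin.last n) then
    -∑ j ∈ Finset.univ.erase j₁, 1 / w W j
  else 0

/-- The matrix `𝓛`: out-degrees minus adjacency matrix plus perturbation. -/
noncomputable def lap : Matrix (DCVert n m) (DCVert n m) ℝ :=
  Matrix.diagonal (fun x => ∑ y, adj W j₁ x y) - adj W j₁ + perturbation W j₁

end DC

namespace DCPresentation

variable {U : Type*} {G : Digraph U} (P : DCPresentation G) (W : U → U → ℝ)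

/-- The weights of `G` read on `dC(n; m₁, …, m_r)`. -/
def weight : DCVert P.n P.m → DCVert P.n P.m → ℝ := fun x y => W (P.iso x) (P.iso y)

/-- The cycles are numbered such that `w_1 ≤ w_2 ≤ ⋯ ≤ w_r`. -/
def IsOrdered : Prop := Monotone (DC.w (P.weight W))

/-- The first index. -/
def first : Fin P.r := ⟨0, P.one_le_r⟩

/-- The data `λ, α, β, 𝓛` of `dC(n; m₁, …, m_r)`, read on the vertices of `G`. -/
noncomputable def lapData : LapData U where
  lam := DC.lam (P.weight W) P.first
  α u := DC.alpha (P.weight W) P.first (P.iso.symm u)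
  β u := DC.beta (P.weight W) P.first (P.iso.symm u)
  L := Matrix.of fun u v => DC.lap (P.weight W) P.first (P.iso.symm u) (P.iso.symm v)

end DCPresentation

open Classical in
/-- The composition of data `λ_t, α_t, β_t, 𝓛_t` given on the blocks of `G`:
`λ = ∑ λ_t`, `α(v) = ∑ α_t(v) - (bi(v) - 1)`, `β(v) = ∑ β_t(v) - (bi(v) - 1)`, where `t` runs over
the blocks containing `v` and `bi(v)` is their number, and `𝓛` is the sum of the `𝓛_t`, each
extended by zero. -/
noncomputable def composition {V : Type*} [Fintype V] (G : Digraph V)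
    (B : ∀ t : Block G, LapData t.1) : LapData V where
  lam := ∑ t, (B t).lam
  α v := (∑ t : Block G, if h : v ∈ t.1 then (B t).α ⟨v, h⟩ else 0) - ((blockIndex G v : ℝ) - 1)
  β v := (∑ t : Block G, if h : v ∈ t.1 then (B t).β ⟨v, h⟩ else 0) - ((blockIndex G v : ℝ) - 1)
  L := ∑ t : Block G, Matrix.of fun u v =>
    if h : u ∈ t.1 ∧ v ∈ t.1 then (B t).L ⟨u, h.1⟩ ⟨v, h.2⟩ else 0

end CactoidType

/-! For a matrix `D`, the identities `∑ β = 1`, `D β = λ 1`, `D 𝓛 = 1 αᵀ - I` and the vanishing of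
the row and column sums of `𝓛` (`IsLapExpressible`) contain all that is needed. If `det D ≠ 0`, then
`λ ≠ 0`, since otherwise `β = 0`; and `D (-𝓛 + β αᵀ / λ) = I`. Applying the adjugate to `D β = λ 1`
and adding up the entries gives `det D = λ cof D`. It remains to prove the identities for single
blocks and to see that they survive composition.

In `dC(n; m₁, …, m_r)` every vertex `x ≠ u_n` has a single out-neighbour `x'`. With `W` the weight
of this edge and `w` the weight of the cheapest cycle through it, row `x` minus row `x'` of the
distance matrix is `W 1ᵀ - w e_xᵀ` (`distMatrix_inl_sub`, `distMatrix_inr_sub`). As `β(x) = W / w`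
and row `x` of `𝓛` is `(e_x - e_{x'})ᵀ / w`, the vector `D β` and the columns of `D 𝓛 + I` do not
change along such edges. They are therefore constant (`eq_of_succ`), and the constants are read off
in the explicitly known row `u_n`. No `w_j` vanishes, because two rows differing by a constant would
contradict `det D ≠ 0` and `cof D ≠ 0`.

For the composition, each vertex `x` has a gate in each block: the only vertex through which walks
from `x` enter the block. Inside a block, row `x` of `D` is the distance to the gate plus the row of
the block matrix at the gate (`distMatrix_eq_add_of_isGate`). Every `y ≠ x` lies in exactly one
block whose gate, seen from `x`, is not `y` (`sum_gate_ne`); this count accounts for the corrections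
`bi(v) - 1`.

Weights may be negative, so the triangle inequality is not available. Distances are computed by
decomposing the sets of simple paths instead. -/

namespace CactoidType

/-! ### Reachability inside a set of vertices -/

/-- `x` and `y` are joined by a walk all of whose vertices lie in `A`. -/
def ReachableIn {V : Type*} (H : SimpleGraph V) (A : Set V) (x y : V) : Prop :=
  ∃ p : H.Walk x y, ∀ z ∈ p.support, z ∈ A

namespace ReachableIn

variable {V : Type*} {H : SimpleGraph V} {A B : Set V} {x y z : V}

theorem refl (hx : x ∈ A) : ReachableIn H A x x := ⟨.nil, by simpa using hx⟩

theorem symm (h : ReachableIn H A x y) : ReachableIn H A y x := by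
  obtain ⟨p, hp⟩ := h
  exact ⟨p.reverse, by simpa using hp⟩

theorem trans (h : ReachableIn H A x y) (h' : ReachableIn H A y z) : ReachableIn H A x z := by
  obtain ⟨p, hp⟩ := h
  obtain ⟨q, hq⟩ := h'
  refine ⟨p.append q, fun a ha => ?_⟩
  rw [SimpleGraph.Walk.mem_support_append_iff] at ha
  exact ha.elim (hp a) (hq a)

theorem mono (h : ReachableIn H A x y) (hAB : A ⊆ B) : ReachableIn H B x y := by
  obtain ⟨p, hp⟩ := h
  exact ⟨p, fun a ha => hAB (hp a ha)⟩

theorem left_mem (h : ReachableIn H A x y) : x ∈ A := by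
  obtain ⟨p, hp⟩ := h
  exact hp _ p.start_mem_support

theorem right_mem (h : ReachableIn H A x y) : y ∈ A := h.symm.left_mem

theorem of_adj (h : H.Adj x y) (hx : x ∈ A) (hy : y ∈ A) : ReachableIn H A x y :=
  ⟨h.toWalk, by simp [SimpleGraph.Adj.toWalk, hx, hy]⟩

theorem head (h : H.Adj x y) (hx : x ∈ A) (hyz : ReachableIn H A y z) : ReachableIn H A x z :=
  (of_adj h hx hyz.left_mem).trans hyz

/-- A walk that ends in `S` has a first vertex in `S`. -/
theorem exists_first_mem {S : Set V} (h : ReachableIn H A x y) (hx : x ∉ S) (hy : y ∈ S) :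
    ∃ c p, ReachableIn H Sᶜ x c ∧ H.Adj c p ∧ p ∈ S ∧ p ∈ A := by
  obtain ⟨w, hw⟩ := h
  induction w with
  | nil => exact absurd hy hx
  | @cons a b c hab w ih =>
    by_cases hb : b ∈ S
    · exact ⟨a, b, refl hx, hab, hb, hw b (by simp)⟩
    · obtain ⟨d, p, hd, hdp, hp⟩ := ih hb hy fun z hz => hw z (by simp [hz])
      exact ⟨d, p, head hab hx hd, hdp, hp⟩

theorem of_connected (hH : H.Connected) (x y : V) : ReachableIn H Set.univ x y := by
  obtain ⟨p⟩ := hH.preconnected x y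
  exact ⟨p, fun _ _ => Set.mem_univ _⟩

end ReachableIn

theorem reachable_induce_iff {V : Type*} {H : SimpleGraph V} {A : Set V} (x y : A) :
    (H.induce A).Reachable x y ↔ ReachableIn H A x y := by
  constructor
  · rintro ⟨p⟩
    refine ⟨p.map (SimpleGraph.Embedding.induce A).toHom, fun z hz => ?_⟩
    obtain ⟨a, -, rfl⟩ := List.mem_map.1 ((congrArg (z ∈ ·)
      (SimpleGraph.Walk.support_map (SimpleGraph.Embedding.induce A).toHom p)).mp hz)
    exact a.2
  · rintro ⟨p, hp⟩
    exact ⟨p.induce A hp⟩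

/-! ### Connected sets of vertices without cut-vertex -/

/-- The subgraph induced on `S` is connected and has no cut-vertex. -/
def IsBiconnected {V : Type*} (H : SimpleGraph V) (S : Finset V) : Prop :=
  S.Nonempty ∧ (∀ x ∈ S, ∀ y ∈ S, ReachableIn H S x y) ∧
    ∀ v ∈ S, ∀ x ∈ S, ∀ y ∈ S, x ≠ v → y ≠ v → ReachableIn H (S \ {v}) x y

section Blocks

variable {V : Type*} {G : Digraph V} {H : SimpleGraph V} {S T : Finset V}

theorem toSimpleGraphInclusive_induce (G : Digraph V) (S : Finset V) :
    (induce G S).toSimpleGraphInclusive = G.toSimpleGraphInclusive.induce (S : Set V) := by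
  ext x y
  simp only [Digraph.toSimpleGraphInclusive, induce, SimpleGraph.fromRel_adj, ne_eq,
    SimpleGraph.comap_adj, Function.Embedding.subtype_apply, Subtype.ext_iff]

theorem not_isCutVertex_induce_iff (v : S) :
    ¬ IsCutVertex (induce G S) v ↔ ∀ x ∈ S, ∀ y ∈ S, x ≠ v → y ≠ v →
      ReachableIn G.toSimpleGraphInclusive (S \ {v.1}) x y := by
  rw [IsCutVertex, not_not, toSimpleGraphInclusive_induce]
  constructor
  · intro h x hx y hy hxv hyv
    obtain ⟨p, hp⟩ := (reachable_induce_iff _ _).1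
      (h ⟨⟨x, hx⟩, by simpa [Subtype.ext_iff] using hxv⟩
        ⟨⟨y, hy⟩, by simpa [Subtype.ext_iff] using hyv⟩)
    refine ⟨p.map (SimpleGraph.Embedding.induce _).toHom, fun z hz => ?_⟩
    obtain ⟨a, ha, rfl⟩ := List.mem_map.1 ((congrArg (z ∈ ·)
      (SimpleGraph.Walk.support_map (SimpleGraph.Embedding.induce _).toHom p)).mp hz)
    have := hp a ha
    exact ⟨a.2, fun h => this (Subtype.ext h)⟩
  · intro h x y
    obtain ⟨p, hp⟩ := h x.1 x.1.2 y.1 y.1.2 (fun h => x.2 (Subtype.ext h))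
      (fun h => y.2 (Subtype.ext h))
    refine (reachable_induce_iff _ _).2 ⟨p.induce S fun z hz => (hp z hz).1, fun z hz => ?_⟩
    rw [SimpleGraph.Walk.support_induce] at hz
    exact fun h => (hp z ((List.mem_attachWith ..).1 hz)).2 (congrArg Subtype.val h)

/-- Blocks are handled from here on through walks in the one ambient graph rather than through
graphs on subtypes. -/
theorem isBlock_iff : IsBlock G S ↔ Maximal (IsBiconnected G.toSimpleGraphInclusive) S := by
  unfold IsBlock
  congr! 2 with T
  simp only [not_isCutVertex_induce_iff]
  rw [toSimpleGraphInclusive_induce, SimpleGraph.connected_iff, IsBiconnected, and_assoc,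
    and_left_comm]
  refine and_congr ?_ (and_congr ?_ ?_)
  · simp [Finset.Nonempty]
  · constructor
    · intro h x hx y hy
      exact (reachable_induce_iff _ _).1 (h ⟨x, hx⟩ ⟨y, hy⟩)
    · intro h x y
      exact (reachable_induce_iff _ _).2 (h x x.2 y y.2)
  · simp only [Subtype.forall]

theorem IsBiconnected.pair {x y : V} [DecidableEq V] (h : H.Adj x y) :
    IsBiconnected H {x, y} := by
  refine ⟨⟨x, by simp⟩, ?_, ?_⟩
  · have hxy : ReachableIn H (({x, y} : Finset V) : Set V) x y := .of_adj h (by simp) (by simp)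
    have hx : ReachableIn H (({x, y} : Finset V) : Set V) x x := .refl (by simp)
    have hy : ReachableIn H (({x, y} : Finset V) : Set V) y y := .refl (by simp)
    simp only [Finset.mem_insert, Finset.mem_singleton, forall_eq_or_imp, forall_eq]
    exact ⟨⟨hx, hxy⟩, hxy.symm, hy⟩
  · intro v hv a ha b hb hav hbv
    have : a = b := by
      simp only [Finset.mem_insert, Finset.mem_singleton] at hv ha hb
      grind
    subst this
    exact .refl ⟨ha, hav⟩

/-- A connected set disjoint from a block has at most one neighbour in the block. -/
theorem eq_of_reachableIn_compl [DecidableEq V] (hS : Maximal (IsBiconnected H) S)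
    {p q c d : V} (hp : p ∈ S) (hq : q ∈ S) (hpc : H.Adj p c) (hqd : H.Adj q d)
    (h : ReachableIn H (S : Set V)ᶜ c d) : p = q := by
  by_contra hpq
  obtain ⟨w, hw⟩ := h
  obtain ⟨Q, hQ, hQS⟩ : ∃ Q : H.Walk c d, Q.IsPath ∧ ∀ z ∈ Q.support, z ∉ S :=
    ⟨w.bypass, w.bypass_isPath, fun z hz => hw z (w.support_bypass_subset_support hz)⟩
  -- If `p ≠ q`, the path `Q` outside `S` is an ear attached to `S` at two different vertices.
  -- Adding an ear creates no cut-vertex, which contradicts maximality of `S`.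
  set T : Finset V := S ∪ Q.support.toFinset with hT
  have hST : S ⊆ T := Finset.subset_union_left
  have hQT : ∀ z ∈ Q.support, z ∈ T := fun z hz => Finset.mem_union_right _ (by simpa using hz)
  have hcT : c ∈ T := hQT _ Q.start_mem_support
  have hdT : d ∈ T := hQT _ Q.end_mem_support
  have key : IsBiconnected H T := by
    have hmem : ∀ z ∈ T, z ∈ S ∨ z ∈ Q.support := by simp [hT]
    have toc : ∀ z ∈ Q.support, ReachableIn H {a | a ∈ Q.support} z c := fun z hz =>
      ReachableIn.symm ⟨Q.takeUntil z hz, fun a ha => Q.support_takeUntil_subset_support hz ha⟩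
    refine ⟨hS.prop.1.mono hST, ?_, ?_⟩
    · have hall : ∀ x ∈ T, ReachableIn H T x p := by
        intro x hx
        rcases hmem x hx with h | h
        · exact (hS.prop.2.1 x h p hp).mono hST
        · exact ((toc x h).mono hQT).trans (.of_adj hpc.symm hcT (hST hp))
      exact fun x hx y hy => (hall x hx).trans (hall y hy).symm
    · intro v hv
      suffices hall : ∃ s, ∀ x ∈ T, x ≠ v → ReachableIn H (T \ {v}) x s by
        obtain ⟨s, hs⟩ := hall
        exact fun x hx y hy hxv hyv => (hs x hx hxv).trans (hs y hy hyv).symm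
      rcases hmem v hv with hvS | hvQ
      -- Deleting `v ∈ S` leaves the ear intact, and at least one of its two attaching vertices `p`,
      -- `q`.
      · have hvQ : v ∉ Q.support := fun h => hQS v h hvS
        have hQ' : {a | a ∈ Q.support} ⊆ ((T : Set V) \ {v}) := fun a ha =>
          ⟨hQT a ha, fun h => hvQ (h ▸ ha)⟩
        have hcv := hQ' Q.start_mem_support
        have hdv := hQ' Q.end_mem_support
        have hsub : ((S : Set V) \ {v}) ⊆ (T : Set V) \ {v} := Set.sdiff_subset_sdiff_left hST
        refine ⟨c, fun x hx hxv => ?_⟩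
        rcases hmem x hx with h | h
        · by_cases hpv : p = v
          · have hqv : q ≠ v := fun h => hpq (hpv.trans h.symm)
            exact ((hS.prop.2.2 v hvS x h q hq hxv hqv).mono hsub).trans
              (.head hqd ⟨hST hq, hqv⟩ ((toc d Q.end_mem_support).mono hQ'))
          · exact ((hS.prop.2.2 v hvS x h p hp hxv hpv).mono hsub).trans
              (.of_adj hpc ⟨hST hp, hpv⟩ hcv)
        · exact (toc x h).mono hQ'
      -- Deleting `v` on the ear leaves `S` intact. As `Q` is a path, the part before `v` still
      -- hangs on `p` and the part after `v` on `q`.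
      · have hvS : v ∉ S := hQS v hvQ
        have hsub : (S : Set V) ⊆ (T : Set V) \ {v} := fun a ha => ⟨hST ha, fun h => hvS (h ▸ ha)⟩
        refine ⟨p, fun x hx hxv => ?_⟩
        rcases hmem x hx with h | h
        · exact (hS.prop.2.1 x h p hp).mono hsub
        · rw [← Q.take_spec hvQ, SimpleGraph.Walk.mem_support_append_iff] at h
          rcases h with h | h
          · have h1 : ReachableIn H ((T : Set V) \ {v}) c x := by
              refine ⟨(Q.takeUntil v hvQ).takeUntil x h, fun a ha => ⟨hQT a ?_, ?_⟩⟩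
              · exact Q.support_takeUntil_subset_support hvQ
                  ((Q.takeUntil v hvQ).support_takeUntil_subset_support h ha)
              · rintro rfl
                exact SimpleGraph.Walk.endpoint_notMem_support_takeUntil (hQ.takeUntil hvQ) h
                  hxv.symm ha
            exact h1.symm.trans (.of_adj hpc.symm h1.left_mem (hsub hp))
          · have h' : x ∈ (Q.dropUntil v hvQ).reverse.support := by simpa using h
            have h1 : ReachableIn H ((T : Set V) \ {v}) d x := by
              refine ⟨(Q.dropUntil v hvQ).reverse.takeUntil x h', fun a ha => ⟨hQT a ?_, ?_⟩⟩
              · have := (Q.dropUntil v hvQ).reverse.support_takeUntil_subset_support h' ha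
                exact Q.support_dropUntil_subset_support hvQ (by simpa using this)
              · rintro rfl
                exact SimpleGraph.Walk.endpoint_notMem_support_takeUntil
                  (hQ.dropUntil hvQ).reverse h' hxv.symm ha
            exact (h1.symm.trans (.of_adj hqd.symm h1.left_mem (hsub hq))).trans
              ((hS.prop.2.1 q hq p hp).mono hsub)
  exact hQS c Q.start_mem_support (hS.le_of_ge key hST hcT)

/-! ### Gates -/

/-- Every walk from `x` to `S` enters `S` in the vertex `p`. -/
structure IsGate (H : SimpleGraph V) (S : Finset V) (x p : V) : Prop where
  mem : p ∈ S
  reachableIn : ReachableIn H (insert p (S : Set V)ᶜ) x p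
  not_reachableIn : ∀ s ∈ S, ¬ ReachableIn H {p}ᶜ x s

theorem isGate_self {x : V} (hx : x ∈ S) : IsGate H S x x :=
  ⟨hx, .refl (by simp), fun _ _ h => h.left_mem rfl⟩

theorem IsGate.eq_of_mem {x p : V} (h : IsGate H S x p) (hx : x ∈ S) : p = x := by
  by_contra hne
  exact h.not_reachableIn x hx (.refl fun h => hne h.symm)

/-- The gate is the entry point `p` of any walk into `S`. A walk avoiding `p` would enter at some `q
≠ p`, and the parts of the two walks before entry connect a neighbour of `p` with a neighbour of `q`
outside `S`, against `eq_of_reachableIn_compl`. -/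
theorem exists_isGate [DecidableEq V] (hH : H.Connected) (hS : Maximal (IsBiconnected H) S)
    (x : V) : ∃ p, IsGate H S x p := by
  by_cases hx : x ∈ S
  · exact ⟨x, isGate_self hx⟩
  obtain ⟨s, hs⟩ := hS.prop.1
  obtain ⟨c, p, hxc, hcp, hp, -⟩ :=
    (ReachableIn.of_connected hH x s).exists_first_mem (S := S) hx hs
  refine ⟨p, hp, ?_, fun s hs h => ?_⟩
  · exact (hxc.mono (Set.subset_insert _ _)).trans
      (.of_adj hcp (Or.inr hxc.right_mem) (Or.inl rfl))
  · obtain ⟨d, q, hxd, hdq, hq, hqp⟩ := h.exists_first_mem (S := S) hx hs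
    exact hqp (eq_of_reachableIn_compl hS hp hq hcp.symm hdq.symm (hxc.symm.trans hxd)).symm

/-- Two blocks whose gates, seen from `x`, differ from their common vertex `y` are equal. -/
theorem eq_of_isGate_ne {x y p q : V} (hS : Maximal (IsBiconnected H) S)
    (hT : Maximal (IsBiconnected H) T) (hgate : ∀ z, ∃ g, IsGate H S z g)
    (hyS : y ∈ S) (hyT : y ∈ T) (hp : IsGate H S x p) (hq : IsGate H T x q)
    (hpy : p ≠ y) (hqy : q ≠ y) : S = T := by
  have hxp : ReachableIn H {y}ᶜ x p := hp.reachableIn.mono (by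
    rintro a (rfl | ha) rfl
    exacts [hpy rfl, ha hyS])
  have hxq : ReachableIn H {y}ᶜ x q := hq.reachableIn.mono (by
    rintro a (rfl | ha) rfl
    exacts [hqy rfl, ha hyT])
  have hsub : T ⊆ S := by
    intro z hz
    by_cases hzy : z = y
    · exact hzy ▸ hyS
    obtain ⟨g, hg⟩ := hgate z
    -- From `z` to `q` inside `T`, then to `x`, then to `p`, always avoiding `y`. Hence `y` is not
    -- the gate of `z` in `S`.
    have hzp : ReachableIn H {y}ᶜ z p :=
      ((hT.prop.2.2 y hyT z hz q hq.mem hzy hqy).mono fun a ha => ha.2).trans (hxq.symm.trans hxp)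
    have hgy : g ≠ y := by
      rintro rfl
      exact hg.not_reachableIn p hp.mem hzp
    -- For `z ∉ S`, a walk inside `T` from `z` to `y` can avoid the gate `g`, and so enters `S`
    -- illegally.
    by_contra hzS
    have hzg : z ≠ g := fun h => hzS (h ▸ hg.mem)
    refine hg.not_reachableIn y hyS ?_
    by_cases hgT : g ∈ T
    · exact (hT.prop.2.2 g hgT z hz y hyT hzg hgy.symm).mono fun a ha => ha.2
    · exact (hT.prop.2.1 z hz y hyT).mono fun a ha h => hgT (h ▸ ha)
  exact (hT.eq_of_le hS.prop hsub).symm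

/-- For `x ≠ y` some block contains `y` and has a gate, seen from `x`, different from `y`. -/
theorem exists_isGate_ne [Fintype V] [DecidableEq V] (hH : H.Connected) {x y : V} (hxy : x ≠ y) :
    ∃ S, Maximal (IsBiconnected H) S ∧ y ∈ S ∧ ∀ p, IsGate H S x p → p ≠ y := by
  -- `z` is the vertex just before a walk from `x` first meets `y`. A block containing the edge `zy`
  -- is reached from `x` at `z` without using `y`.
  obtain ⟨z, y', hxz, hzy, rfl, -⟩ :=
    (ReachableIn.of_connected hH x y).exists_first_mem (S := {y}) hxy rfl
  obtain ⟨S, hle, hS⟩ := Finite.exists_le_maximal (IsBiconnected.pair hzy)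
  refine ⟨S, hS, hle (by simp), ?_⟩
  rintro p hp rfl
  exact hp.not_reachableIn z (hle (by simp)) hxz

end Blocks

/-! ### Directed paths -/

section Paths

variable {V : Type*} {G : Digraph V} {W : V → V → ℝ} {x y z p : V} {l l₁ l₂ : List V}

theorem pathWeight_append (W : V → V → ℝ) (l₁ : List V) (p : V) (l₂ : List V) :
    pathWeight W (l₁ ++ p :: l₂) = pathWeight W (l₁ ++ [p]) + pathWeight W (p :: l₂) := by
  induction l₁ with
  | nil => simp [pathWeight]
  | cons a l₁ ih =>
    cases l₁ with
    | nil => simp [pathWeight]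
    | cons b l₁ =>
      simp only [List.cons_append, pathWeight] at ih ⊢
      rw [ih, add_assoc]

theorem pathWeight_map {U : Type*} (f : U → V) (W : V → V → ℝ) (l : List U) :
    pathWeight W (l.map f) = pathWeight (fun a b => W (f a) (f b)) l := by
  induction l with
  | nil => rfl
  | cons a l ih =>
    cases l with
    | nil => rfl
    | cons b l => simpa [pathWeight] using ih

theorem isDirectedPath_append_iff : IsDirectedPath G x y (l₁ ++ p :: l₂) ↔
    IsDirectedPath G x p (l₁ ++ [p]) ∧ IsDirectedPath G p y (p :: l₂) ∧
      ∀ a ∈ l₁, a ∉ p :: l₂ := by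
  unfold IsDirectedPath
  rw [List.isChain_split]
  simp only [List.nodup_append, List.head?_append, List.getLast?_append, List.head?_cons,
    List.getLast?_cons, List.mem_singleton, List.nodup_singleton]
  simp only [Option.or_some, Option.some_or, Option.some.injEq]
  grind

theorem isDirectedPath_cons_cons_iff {a b : V} : IsDirectedPath G x y (a :: b :: l) ↔
    a = x ∧ G.Adj a b ∧ a ∉ b :: l ∧ IsDirectedPath G b y (b :: l) := by
  simp only [IsDirectedPath, List.isChain_cons_cons, List.nodup_cons, List.head?_cons,
    List.getLast?_cons_cons, Option.some.injEq]
  tauto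

theorem isDirectedPath_append_pair_iff {a b : V} : IsDirectedPath G x y (l ++ [a, b]) ↔
    IsDirectedPath G x a (l ++ [a]) ∧ G.Adj a b ∧ b = y ∧ b ∉ l ++ [a] := by
  rw [isDirectedPath_append_iff, isDirectedPath_cons_cons_iff]
  simp only [IsDirectedPath, List.mem_cons, List.not_mem_nil, or_false, List.isChain_singleton,
    List.nodup_singleton, List.head?_cons, List.getLast?_singleton, Option.some.injEq,
    List.mem_append]
  grind

theorem isDirectedPath_singleton_iff {a : V} :
    IsDirectedPath G x y [a] ↔ a = x ∧ a = y := by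
  simp [IsDirectedPath]

theorem not_isDirectedPath_nil : ¬ IsDirectedPath G x y [] := by
  simp [IsDirectedPath]

theorem IsDirectedPath.exists_eq_cons (h : IsDirectedPath G x y l) : ∃ l', l = x :: l' := by
  cases l with
  | nil => exact absurd h not_isDirectedPath_nil
  | cons a l => exact ⟨l, by simpa using h.2.2.1⟩

theorem IsDirectedPath.exists_eq_append (h : IsDirectedPath G x y l) : ∃ l', l = l' ++ [y] :=
  List.getLast?_eq_some_iff.1 h.2.2.2

theorem isDirectedPath_self_iff : IsDirectedPath G x x l ↔ l = [x] := by
  constructor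
  · intro h
    obtain ⟨l, rfl⟩ := h.exists_eq_cons
    rcases List.eq_nil_or_concat l with rfl | ⟨l, b, rfl⟩
    · rfl
    · have h1 := h.2.2.2
      have h2 := h.2.1
      simp only [List.concat_eq_append, ← List.cons_append, List.getLast?_concat,
        Option.some.injEq] at h1
      simp [h1] at h2
  · rintro rfl
    exact isDirectedPath_singleton_iff.2 ⟨rfl, rfl⟩

theorem exists_isDirectedPath (h : Relation.ReflTransGen G.Adj x y) :
    ∃ l, IsDirectedPath G x y l := by
  induction h using Relation.ReflTransGen.head_induction_on with
  | refl => exact ⟨[y], isDirectedPath_self_iff.2 rfl⟩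
  | @head a c hac _ ih =>
    obtain ⟨l, hl⟩ := ih
    -- If `a` already lies on the path, the part starting at `a` is used.
    by_cases ha : a ∈ l
    · obtain ⟨l₁, l₂, rfl⟩ := List.append_of_mem ha
      exact ⟨_, (isDirectedPath_append_iff.1 hl).2.1⟩
    · obtain ⟨l', rfl⟩ := hl.exists_eq_cons
      exact ⟨a :: c :: l', isDirectedPath_cons_cons_iff.2 ⟨rfl, hac, ha, hl⟩⟩

theorem isDirectedPath_map_iff {U : Type*} {G' : Digraph U} {f : U → V}
    (hf : Function.Injective f) (hG : ∀ a b, G'.Adj a b ↔ G.Adj (f a) (f b)) {a b : U}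
    {l : List U} : IsDirectedPath G (f a) (f b) (l.map f) ↔ IsDirectedPath G' a b l := by
  simp only [IsDirectedPath, List.isChain_map, List.nodup_map_iff hf, List.head?_map,
    List.getLast?_map, ← hG, Option.map_eq_some_iff, hf.eq_iff, exists_eq_right]

theorem IsDirectedPath.reachableIn {A : Set V} (h : IsDirectedPath G x y l)
    (hA : ∀ a ∈ l, a ∈ A) : ReachableIn G.toSimpleGraphInclusive A x y := by
  induction l generalizing x with
  | nil => exact absurd h not_isDirectedPath_nil
  | cons a l ih =>
    cases l with
    | nil =>
      obtain ⟨rfl, rfl⟩ := isDirectedPath_singleton_iff.1 h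
      exact .refl (hA _ (by simp))
    | cons b l =>
      obtain ⟨rfl, hab, hnot, h'⟩ := isDirectedPath_cons_cons_iff.1 h
      refine .head ?_ (hA _ (by simp)) (ih h' fun c hc => hA c (List.mem_cons_of_mem _ hc))
      exact (SimpleGraph.fromRel_adj ..).2 ⟨fun h => hnot (by simp [h]), Or.inl hab⟩

/-! ### The weights of directed paths -/

/-- The total weights of the directed paths from `x` to `y`. -/
def pathWeights (G : Digraph V) (W : V → V → ℝ) (x y : V) : Set ℝ :=
  {c | ∃ l, IsDirectedPath G x y l ∧ pathWeight W l = c}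

theorem pathWeights_nonempty (h : ∃ l, IsDirectedPath G x y l) :
    (pathWeights G W x y).Nonempty := by
  obtain ⟨l, hl⟩ := h
  exact ⟨_, l, hl, rfl⟩

/-- There are finitely many simple paths, so the infimum defining the distance is a minimum,
whatever the signs of the weights. -/
theorem pathWeights_finite [Finite V] : (pathWeights G W x y).Finite := by
  classical
  have := Fintype.ofFinite V
  refine Set.Finite.subset (Set.finite_range fun l : {l : List V // l.Nodup} => pathWeight W l.1) ?_
  rintro _ ⟨l, hl, rfl⟩
  exact ⟨⟨l, hl.2.1⟩, rfl⟩

theorem distMatrix_apply : distMatrix G W x y = sInf (pathWeights G W x y) := rfl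

theorem distMatrix_self : distMatrix G W x x = 0 := by
  rw [distMatrix_apply]
  have h : pathWeights G W x x = {0} := by
    ext c
    simp [pathWeights, isDirectedPath_self_iff, pathWeight, eq_comm]
  rw [h, csInf_singleton]

theorem distMatrix_le [Finite V] (h : IsDirectedPath G x y l) :
    distMatrix G W x y ≤ pathWeight W l :=
  csInf_le pathWeights_finite.bddBelow ⟨l, h, rfl⟩

theorem le_distMatrix {c : ℝ} (hne : ∃ l, IsDirectedPath G x y l)
    (h : ∀ l, IsDirectedPath G x y l → c ≤ pathWeight W l) : c ≤ distMatrix G W x y := by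
  refine le_csInf (pathWeights_nonempty hne) ?_
  rintro _ ⟨l, hl, rfl⟩
  exact h l hl

theorem distMatrix_map {U : Type*} {G' : Digraph U} {f : U → V}
    (hf : Function.Injective f) (hG : ∀ a b, G'.Adj a b ↔ G.Adj (f a) (f b)) {a b : U}
    (hl : ∀ l, IsDirectedPath G (f a) (f b) l → ∀ c ∈ l, c ∈ Set.range f) :
    distMatrix G W (f a) (f b) = distMatrix G' (fun a b => W (f a) (f b)) a b := by
  rw [distMatrix_apply, distMatrix_apply]
  congr 1
  ext c
  constructor
  · rintro ⟨l, h, rfl⟩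
    obtain ⟨l, rfl⟩ : l ∈ Set.range (List.map f) := by
      rw [Set.range_list_map]
      exact hl l h
    exact ⟨l, (isDirectedPath_map_iff hf hG).1 h, (pathWeight_map ..).symm⟩
  · rintro ⟨l, h, rfl⟩
    exact ⟨l.map f, (isDirectedPath_map_iff hf hG).2 h, pathWeight_map ..⟩

open scoped Pointwise in
/-- If all paths from `x` to `z` pass through `p`, and arbitrary paths from `x` to `p` and from `p`
to `z` can be joined, then the distance is additive. -/
theorem distMatrix_eq_add [Finite V] (hxp : ∃ l, IsDirectedPath G x p l)
    (hpz : ∃ l, IsDirectedPath G p z l) (hmem : ∀ l, IsDirectedPath G x z l → p ∈ l)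
    (hdisj : ∀ l₁ l₂, IsDirectedPath G x p (l₁ ++ [p]) → IsDirectedPath G p z (p :: l₂) →
      ∀ a ∈ l₁, a ∉ p :: l₂) :
    distMatrix G W x z = distMatrix G W x p + distMatrix G W p z := by
  simp only [distMatrix_apply]
  rw [← csInf_add (pathWeights_nonempty hxp) pathWeights_finite.bddBelow
    (pathWeights_nonempty hpz) pathWeights_finite.bddBelow]
  congr 1
  ext c
  rw [Set.mem_add]
  constructor
  · rintro ⟨l, h, rfl⟩
    obtain ⟨l₁, l₂, rfl⟩ := List.append_of_mem (hmem l h)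
    obtain ⟨h₁, h₂, -⟩ := isDirectedPath_append_iff.1 h
    exact ⟨_, ⟨_, h₁, rfl⟩, _, ⟨_, h₂, rfl⟩, (pathWeight_append ..).symm⟩
  · rintro ⟨_, ⟨l, h₁, rfl⟩, _, ⟨l', h₂, rfl⟩, rfl⟩
    obtain ⟨l₁, rfl⟩ := h₁.exists_eq_append
    obtain ⟨l₂, rfl⟩ := h₂.exists_eq_cons
    exact ⟨_, isDirectedPath_append_iff.2 ⟨h₁, h₂, hdisj _ _ h₁ h₂⟩, pathWeight_append ..⟩

/-! ### Vertices with a single out-neighbour or a single in-neighbour -/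

/-- Prepending `x` keeps the path simple: a path from `x'` to `y ≠ x` through `x` would have to
leave `x` for `x'` and so repeat `x'`. -/
theorem isDirectedPath_iff_of_unique_out {x' : V} (hx : ∀ a, G.Adj x a ↔ a = x')
    (hxx' : x ≠ x') (hxy : y ≠ x) :
    IsDirectedPath G x y l ↔ ∃ l', IsDirectedPath G x' y l' ∧ l = x :: l' := by
  constructor
  · intro h
    obtain ⟨l', rfl⟩ := h.exists_eq_cons
    cases l' with
    | nil => exact absurd (isDirectedPath_singleton_iff.1 h).2.symm hxy
    | cons b l =>
      obtain ⟨-, hab, -, h'⟩ := isDirectedPath_cons_cons_iff.1 h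
      obtain rfl := (hx b).1 hab
      exact ⟨_, h', rfl⟩
  · rintro ⟨l', h, rfl⟩
    have hx' : x ∉ l' := by
      intro hmem
      obtain ⟨l₁, l₂, rfl⟩ := List.append_of_mem hmem
      obtain ⟨h₁, h₂, h₃⟩ := isDirectedPath_append_iff.1 h
      cases l₂ with
      | nil => exact hxy (isDirectedPath_singleton_iff.1 h₂).2.symm
      | cons b l₂ =>
        obtain rfl := (hx b).1 (isDirectedPath_cons_cons_iff.1 h₂).2.1
        obtain ⟨l', hl'⟩ := h₁.exists_eq_cons
        cases l₁ with
        | nil => simp_all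
        | cons c l₁ =>
          have : c = b := by simpa using (List.cons.inj hl').1
          exact h₃ c (by simp) (by simp [this])
    obtain ⟨l', rfl⟩ := h.exists_eq_cons
    exact isDirectedPath_cons_cons_iff.2 ⟨rfl, (hx _).2 rfl, hx', h⟩

theorem isDirectedPath_iff_of_unique_in {y' : V} (hy : ∀ a, G.Adj a y ↔ a = y')
    (hyy' : y ≠ y') (hxy : x ≠ y) :
    IsDirectedPath G x y l ↔ ∃ l', IsDirectedPath G x y' l' ∧ l = l' ++ [y] := by
  constructor
  · intro h
    obtain ⟨l', rfl⟩ := h.exists_eq_append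
    rcases List.eq_nil_or_concat l' with rfl | ⟨l, b, rfl⟩
    · exact absurd (isDirectedPath_singleton_iff.1 h).1.symm hxy
    · rw [List.concat_eq_append, List.append_assoc, List.singleton_append,
        isDirectedPath_append_pair_iff] at h
      obtain rfl := (hy b).1 h.2.1
      exact ⟨_, h.1, by simp⟩
  · rintro ⟨l', h, rfl⟩
    have hy' : y ∉ l' := by
      intro hmem
      obtain ⟨l₁, l₂, rfl⟩ := List.append_of_mem hmem
      obtain ⟨h₁, h₂, h₃⟩ := isDirectedPath_append_iff.1 h
      rcases List.eq_nil_or_concat l₁ with rfl | ⟨l, b, rfl⟩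
      · exact hxy (isDirectedPath_singleton_iff.1 h₁).1.symm
      · rw [List.concat_eq_append, List.append_assoc, List.singleton_append,
          isDirectedPath_append_pair_iff] at h₁
        obtain rfl := (hy b).1 h₁.2.1
        exact h₃ b (by simp) (List.mem_of_getLast? h₂.2.2.2)
    obtain ⟨l', rfl⟩ := h.exists_eq_append
    rw [List.append_assoc, List.singleton_append]
    exact isDirectedPath_append_pair_iff.2 ⟨h, (hy _).2 rfl, rfl, hy'⟩

open scoped Pointwise in
theorem distMatrix_of_unique_out [Finite V] (hsc : ∀ x y, ∃ l, IsDirectedPath G x y l) {x' : V}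
    (hx : ∀ a, G.Adj x a ↔ a = x') (hxx' : x ≠ x') (hxy : y ≠ x) :
    distMatrix G W x y = W x x' + distMatrix G W x' y := by
  have h1 : W x x' + distMatrix G W x' y = sInf ({W x x'} + pathWeights G W x' y) := by
    rw [csInf_add (Set.singleton_nonempty _) bddBelow_singleton
      (pathWeights_nonempty (hsc _ _)) pathWeights_finite.bddBelow, csInf_singleton,
      distMatrix_apply]
  rw [h1, distMatrix_apply]
  congr 1
  ext c
  simp only [pathWeights, Set.mem_ofPred_eq, Set.singleton_add, Set.mem_image,
    isDirectedPath_iff_of_unique_out hx hxx' hxy]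
  constructor
  · rintro ⟨_, ⟨l, hl, rfl⟩, rfl⟩
    obtain ⟨l', rfl⟩ := hl.exists_eq_cons
    exact ⟨_, ⟨_, hl, rfl⟩, rfl⟩
  · rintro ⟨_, ⟨l, hl, rfl⟩, rfl⟩
    obtain ⟨l', rfl⟩ := hl.exists_eq_cons
    exact ⟨_, ⟨_, hl, rfl⟩, rfl⟩

theorem pathWeight_append_pair {a b : V} :
    pathWeight W (l ++ [a, b]) = pathWeight W (l ++ [a]) + W a b := by
  rw [pathWeight_append]
  simp [pathWeight]

open scoped Pointwise in
theorem distMatrix_of_unique_in [Finite V] (hsc : ∀ x y, ∃ l, IsDirectedPath G x y l) {y' : V}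
    (hy : ∀ a, G.Adj a y ↔ a = y') (hyy' : y ≠ y') (hxy : x ≠ y) :
    distMatrix G W x y = distMatrix G W x y' + W y' y := by
  have h1 : distMatrix G W x y' + W y' y = sInf (pathWeights G W x y' + {W y' y}) := by
    rw [csInf_add (pathWeights_nonempty (hsc _ _)) pathWeights_finite.bddBelow
      (Set.singleton_nonempty _) bddBelow_singleton, csInf_singleton, distMatrix_apply]
  rw [h1, distMatrix_apply]
  congr 1
  ext c
  simp only [pathWeights, Set.mem_ofPred_eq, Set.add_singleton, Set.mem_image,
    isDirectedPath_iff_of_unique_in hy hyy' hxy]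
  constructor
  · rintro ⟨_, ⟨l, hl, rfl⟩, rfl⟩
    obtain ⟨l', rfl⟩ := hl.exists_eq_append
    exact ⟨_, ⟨_, hl, rfl⟩, by simp [pathWeight_append_pair]⟩
  · rintro ⟨_, ⟨l, hl, rfl⟩, rfl⟩
    obtain ⟨l', rfl⟩ := hl.exists_eq_append
    exact ⟨_, ⟨_, hl, rfl⟩, by simp [pathWeight_append_pair]⟩

end Paths

/-! ### Distances and blocks -/

section BlockDist

variable {V : Type*} {G : Digraph V} {W : V → V → ℝ} {S : Finset V} {x y z p : V}

/-- Directed paths between vertices of a block stay in the block. -/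
theorem IsDirectedPath.mem_of_isBlock {l : List V}
    (hgate : ∀ y, ∃ g, IsGate G.toSimpleGraphInclusive S y g) (h : IsDirectedPath G x z l)
    (hx : x ∈ S) (hz : z ∈ S) : ∀ y ∈ l, y ∈ S := by
  intro y hy
  by_contra hyS
  -- A path that leaves `S` and returns passes through the gate of the outside vertex `y` both
  -- before and after `y`, so it is not simple.
  obtain ⟨g, hg⟩ := hgate y
  obtain ⟨l₁, l₂, rfl⟩ := List.append_of_mem hy
  obtain ⟨h₁, h₂, h₃⟩ := isDirectedPath_append_iff.1 h
  have hgy : g ≠ y := fun h => hyS (h ▸ hg.mem)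
  have hg₁ : g ∈ l₁ ++ [y] := by
    by_contra hnot
    exact hg.not_reachableIn x hx
      (h₁.reachableIn (A := {g}ᶜ) fun a ha h => hnot (h ▸ ha)).symm
  have hg₂ : g ∈ y :: l₂ := by
    by_contra hnot
    exact hg.not_reachableIn z hz (h₂.reachableIn (A := {g}ᶜ) fun a ha h => hnot (h ▸ ha))
  simp only [List.mem_append, List.mem_singleton, hgy, or_false] at hg₁
  exact h₃ g hg₁ hg₂

theorem distMatrix_eq_block (hgate : ∀ y, ∃ g, IsGate G.toSimpleGraphInclusive S y g)
    (x z : S) : distMatrix G W x z = distMatrix (induce G S) (fun a b => W a b) x z :=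
  distMatrix_map (f := Subtype.val) Subtype.val_injective (fun _ _ => Iff.rfl) fun _ hl c hc =>
    ⟨⟨c, hl.mem_of_isBlock hgate x.2 z.2 c hc⟩, rfl⟩

theorem exists_isDirectedPath_induce (hsc : ∀ x y, ∃ l, IsDirectedPath G x y l)
    (hgate : ∀ y, ∃ g, IsGate G.toSimpleGraphInclusive S y g) (x z : S) :
    ∃ l, IsDirectedPath (induce G S) x z l := by
  obtain ⟨l, hl⟩ := hsc x z
  obtain ⟨l, rfl⟩ : l ∈ Set.range (List.map (Subtype.val : S → V)) := by
    rw [Set.range_list_map]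
    exact fun c hc => ⟨⟨c, hl.mem_of_isBlock hgate x.2 z.2 c hc⟩, rfl⟩
  exact ⟨l, (isDirectedPath_map_iff Subtype.val_injective fun _ _ => Iff.rfl).1 hl⟩

/-- All paths from `x` to `z` pass through the gate. Conversely, a path from `p` to `z` stays in
`S`, while a path from `x` to `p` meets `S` only at its end, so the two always join to a simple
path. -/
theorem distMatrix_eq_add_of_isGate [Finite V] (hsc : ∀ x y, ∃ l, IsDirectedPath G x y l)
    (hgate : ∀ y, ∃ g, IsGate G.toSimpleGraphInclusive S y g)
    (hp : IsGate G.toSimpleGraphInclusive S x p) (hz : z ∈ S) :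
    distMatrix G W x z = distMatrix G W x p + distMatrix G W p z := by
  refine distMatrix_eq_add (hsc _ _) (hsc _ _) (fun l hl => ?_) fun l₁ l₂ h₁ h₂ a ha₁ ha₂ => ?_
  · by_contra hnot
    exact hp.not_reachableIn z hz (hl.reachableIn fun a ha h => hnot (h ▸ ha))
  · have haS := h₂.mem_of_isBlock hgate hp.mem hz a ha₂
    obtain ⟨l, l', rfl⟩ := List.append_of_mem ha₁
    rw [List.append_assoc, List.cons_append, isDirectedPath_append_iff] at h₁
    refine hp.not_reachableIn a haS (h₁.1.reachableIn fun b hb hbp => ?_)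
    have hbp : b = p := hbp
    subst hbp
    simp only [List.mem_append, List.mem_singleton] at hb
    rcases hb with hb | hb
    · exact h₁.2.2 _ hb (by simp)
    · have := h₁.2.1.2.1
      simp [hb] at this

end BlockDist

/-! ### Prefix sums -/

/-- The sum of the first `k` entries of `f`. -/
def prefixSum {N : ℕ} (f : Fin N → ℝ) (k : ℕ) : ℝ := ∑ s with s.val < k, f s

section PrefixSum

variable {N : ℕ} (f : Fin N → ℝ)

theorem prefixSum_zero : prefixSum f 0 = 0 := by simp [prefixSum]

theorem prefixSum_succ (i : Fin N) : prefixSum f (i.val + 1) = prefixSum f i.val + f i := by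
  have h : Finset.univ.filter (fun s : Fin N => s.val < i.val + 1)
      = insert i (Finset.univ.filter fun s : Fin N => s.val < i.val) := by
    ext s
    simp only [Finset.mem_filter, Finset.mem_univ, true_and, Finset.mem_insert, Fin.ext_iff]
    omega
  rw [prefixSum, h, Finset.sum_insert (by simp), add_comm, prefixSum]

theorem prefixSum_of_le {k : ℕ} (hk : N ≤ k) : prefixSum f k = ∑ i, f i := by
  rw [prefixSum, Finset.filter_true_of_mem]
  exact fun i _ => lt_of_lt_of_le i.isLt hk

/-- Pairs are grouped by their larger index. -/
theorem pairSum_eq : pairSum f = ∑ i, prefixSum f i.val * f i := by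
  simp only [pairSum, prefixSum, Finset.sum_filter, Finset.sum_mul, ite_mul, zero_mul]
  rw [Fintype.sum_prod_type_right]
  rfl

end PrefixSum

namespace DC

variable {n r : ℕ} {m : Fin r → ℕ}

/-! ### Neighbours in `dC(n; m₁, …, m_r)` -/

theorem pathVertex_zero (j : Fin r) : pathVertex (n := n) (m := m) j 0 = .inl (Fin.last n) := rfl

theorem pathVertex_last (j : Fin r) :
    pathVertex (n := n) (m := m) j (Fin.last (m j + 1)) = .inl 0 := by
  rw [← Fin.succ_last]
  exact Fin.lastCases_last (motive := fun _ => DCVert n m)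

/-- The vertex `inr ⟨j, k⟩` has position `k + 1` on the `j`-th path. Its successor there is
`pathVertex j k.succ.succ`, its predecessor `pathVertex j k.castSucc.castSucc`. -/
theorem pathVertex_castSucc_succ (j : Fin r) (k : Fin (m j)) :
    pathVertex (n := n) (m := m) j k.castSucc.succ = .inr ⟨j, k⟩ := by
  simp [pathVertex]

theorem pathVertex_succ_castSucc (j : Fin r) (k : Fin (m j)) :
    pathVertex (n := n) (m := m) j k.succ.castSucc = .inr ⟨j, k⟩ := by
  rw [← Fin.succ_castSucc, pathVertex_castSucc_succ]

theorem pathVertex_succ_succ_of_lt (j : Fin r) (k : Fin (m j)) (h : k.val + 1 < m j) :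
    pathVertex (n := n) (m := m) j k.succ.succ = .inr ⟨j, ⟨k.val + 1, h⟩⟩ := by
  rw [← pathVertex_castSucc_succ]
  rfl

theorem pathVertex_succ_succ_of_eq (j : Fin r) (k : Fin (m j)) (h : k.val + 1 = m j) :
    pathVertex (n := n) (m := m) j k.succ.succ = .inl 0 := by
  rw [← pathVertex_last j]
  congr 1
  ext
  simp [h]

theorem adj_inl_castSucc_iff (i : Fin n) (a : DCVert n m) :
    (dC n m).Adj (.inl i.castSucc) a ↔ a = .inl i.succ := by
  rcases a with q | ⟨j, k⟩
  · simp only [dC, Sum.inl.injEq, Fin.ext_iff, Fin.val_succ, Fin.val_castSucc]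
  · simp [dC, i.isLt.ne]

theorem adj_inr_iff (j : Fin r) (k : Fin (m j)) (a : DCVert n m) :
    (dC n m).Adj (.inr ⟨j, k⟩) a ↔ a = pathVertex j k.succ.succ := by
  rcases lt_or_eq_of_le (Nat.succ_le_of_lt k.isLt) with h | h
  · rw [pathVertex_succ_succ_of_lt j k h]
    rcases a with q | ⟨l, i⟩
    · simp only [dC, reduceCtorEq, iff_false]
      omega
    · simp only [dC, Sum.inr.injEq, Sigma.mk.injEq]
      constructor
      · rintro ⟨rfl, hi⟩
        exact ⟨rfl, heq_of_eq (Fin.ext hi)⟩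
      · rintro ⟨rfl, hi⟩
        exact ⟨rfl, congrArg Fin.val (eq_of_heq hi)⟩
  · rw [pathVertex_succ_succ_of_eq j k h]
    rcases a with q | ⟨l, i⟩
    · simp only [dC, Sum.inl.injEq, Fin.ext_iff, Fin.val_zero]
      omega
    · simp only [dC, reduceCtorEq, iff_false]
      rintro ⟨rfl, hi⟩
      omega

theorem adj_inl_succ_iff (i : Fin n) (a : DCVert n m) :
    (dC n m).Adj a (.inl i.succ) ↔ a = .inl i.castSucc := by
  rcases a with q | ⟨j, k⟩
  · simp only [dC, Sum.inl.injEq, Fin.ext_iff, Fin.val_succ, Fin.val_castSucc]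
    omega
  · simp [dC]

theorem adj_to_inr_iff (j : Fin r) (k : Fin (m j)) (a : DCVert n m) :
    (dC n m).Adj a (.inr ⟨j, k⟩) ↔ a = pathVertex j k.castSucc.castSucc := by
  obtain ⟨k, hk⟩ := k
  cases k with
  | zero =>
    have h : pathVertex (n := n) (m := m) j (Fin.castSucc (Fin.castSucc ⟨0, hk⟩))
        = .inl (Fin.last n) := pathVertex_zero j
    rw [h]
    rcases a with q | ⟨l, i⟩
    · simp only [dC, Sum.inl.injEq, Fin.ext_iff, Fin.val_last, and_true]
    · simp [dC]
  | succ k =>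
    have h : pathVertex (n := n) (m := m) j (Fin.castSucc (Fin.castSucc ⟨k + 1, hk⟩))
        = .inr ⟨j, ⟨k, by omega⟩⟩ := pathVertex_succ_castSucc j ⟨k, by omega⟩
    rw [h]
    rcases a with q | ⟨l, i⟩
    · simp [dC]
    · simp only [dC, Sum.inr.injEq, Sigma.mk.injEq]
      constructor
      · rintro ⟨rfl, hi⟩
        exact ⟨rfl, heq_of_eq (Fin.ext (by simpa using hi.symm))⟩
      · rintro ⟨rfl, hi⟩
        exact ⟨rfl, by simp [eq_of_heq hi]⟩

theorem inl_castSucc_ne_succ (i : Fin n) :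
    (.inl i.castSucc : DCVert n m) ≠ .inl i.succ := by
  simp [Fin.ext_iff]

theorem inr_ne_pathVertex_succ_succ (j : Fin r) (k : Fin (m j)) :
    (.inr ⟨j, k⟩ : DCVert n m) ≠ pathVertex j k.succ.succ := by
  rcases lt_or_eq_of_le (Nat.succ_le_of_lt k.isLt) with h | h
  · rw [pathVertex_succ_succ_of_lt j k h]
    simp [Fin.ext_iff]
  · simp [pathVertex_succ_succ_of_eq j k h]

theorem inr_ne_pathVertex_castSucc_castSucc (j : Fin r) (k : Fin (m j)) :
    (.inr ⟨j, k⟩ : DCVert n m) ≠ pathVertex j k.castSucc.castSucc := by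
  obtain ⟨k, hk⟩ := k
  cases k with
  | zero => exact fun h => by simpa using h.trans (pathVertex_zero j)
  | succ k =>
    intro h
    have := h.trans (pathVertex_succ_castSucc j ⟨k, by omega⟩)
    simp at this

/-- A function that does not change along the edges leaving vertices other than `u_n`
is constant. -/
theorem eq_of_succ {f : DCVert n m → ℝ} (hu : ∀ i : Fin n, f (.inl i.castSucc) = f (.inl i.succ))
    (hv : ∀ j (k : Fin (m j)), f (.inr ⟨j, k⟩) = f (pathVertex j k.succ.succ)) (x : DCVert n m) :
    f x = f (.inl (Fin.last n)) := by
  have h1 : ∀ i, f (.inl i) = f (.inl (Fin.last n)) := fun i => by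
    induction i using Fin.reverseInduction with
    | last => rfl
    | cast i ih => rw [hu, ih]
  rcases x with i | ⟨j, k⟩
  · exact h1 i
  · rw [← h1 0]
    -- `t` is the number of vertices of the `j`-th path between this one and `u_0`.
    obtain ⟨t, ht⟩ : ∃ t, k.val + 1 + t = m j := ⟨m j - (k.val + 1), by omega⟩
    induction t generalizing k with
    | zero => rw [hv, pathVertex_succ_succ_of_eq j k (by omega)]
    | succ t ih =>
      rw [hv, pathVertex_succ_succ_of_lt j k (by omega)]
      exact ih _ (by simp only; omega)

/-! ### Distances in `dC(n; m₁, …, m_r)` -/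

variable {W : DCVert n m → DCVert n m → ℝ}

/-- Tracing back from `inr ⟨j, k⟩`, every in-neighbour is forced until `u_n` is reached, and `u_n ≠
u_0` as `n ≥ 1`. Hence `u_0` may be appended to a path ending in the last vertex of the `j`-th path.
-/
theorem inl_zero_notMem (hn : 1 ≤ n) (j : Fin r) (k : Fin (m j)) {l : List (DCVert n m)}
    (hl : IsDirectedPath (dC n m) (.inl (Fin.last n)) (.inr ⟨j, k⟩) l) : .inl 0 ∉ l := by
  obtain ⟨k, hk⟩ := k
  induction k generalizing l with
  | zero =>
    obtain ⟨l, hl', rfl⟩ := (isDirectedPath_iff_of_unique_in (adj_to_inr_iff j _)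
      (inr_ne_pathVertex_castSucc_castSucc j _) (by simp)).1 hl
    have h : pathVertex (n := n) (m := m) j (Fin.castSucc (Fin.castSucc ⟨0, hk⟩))
        = .inl (Fin.last n) := pathVertex_zero j
    rw [h, isDirectedPath_self_iff] at hl'
    subst hl'
    simp only [List.mem_append, List.mem_singleton, Sum.inl.injEq, reduceCtorEq, or_false,
      Fin.ext_iff, Fin.val_zero, Fin.val_last]
    omega
  | succ k ih =>
    obtain ⟨l, hl', rfl⟩ := (isDirectedPath_iff_of_unique_in (adj_to_inr_iff j _)
      (inr_ne_pathVertex_castSucc_castSucc j _) (by simp)).1 hl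
    have h : pathVertex (n := n) (m := m) j (Fin.castSucc (Fin.castSucc ⟨k + 1, hk⟩))
        = .inr ⟨j, ⟨k, by omega⟩⟩ := pathVertex_succ_castSucc j ⟨k, by omega⟩
    rw [h] at hl'
    simpa using ih (by omega) hl'

theorem distMatrix_inl_castSucc
    (hsc : ∀ x y, ∃ l, IsDirectedPath (dC n m) x y l)
    (i : Fin n) {y : DCVert n m} (hy : y ≠ .inl i.castSucc) :
    distMatrix (dC n m) W (.inl i.castSucc) y
      = commonWeight W i + distMatrix (dC n m) W (.inl i.succ) y :=
  distMatrix_of_unique_out hsc (adj_inl_castSucc_iff i) (inl_castSucc_ne_succ i) hy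

theorem distMatrix_inr
    (hsc : ∀ x y, ∃ l, IsDirectedPath (dC n m) x y l)
    (j : Fin r) (k : Fin (m j)) {y : DCVert n m} (hy : y ≠ .inr ⟨j, k⟩) :
    distMatrix (dC n m) W (.inr ⟨j, k⟩) y
      = ownWeight W j k.succ + distMatrix (dC n m) W (pathVertex j k.succ.succ) y := by
  rw [distMatrix_of_unique_out hsc (adj_inr_iff j k) (inr_ne_pathVertex_succ_succ j k) hy,
    ownWeight, pathVertex_succ_castSucc]

theorem distMatrix_inl_succ
    (hsc : ∀ x y, ∃ l, IsDirectedPath (dC n m) x y l)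
    (i : Fin n) {x : DCVert n m} (hx : x ≠ .inl i.succ) :
    distMatrix (dC n m) W x (.inl i.succ)
      = distMatrix (dC n m) W x (.inl i.castSucc) + commonWeight W i :=
  distMatrix_of_unique_in hsc (adj_inl_succ_iff i) (inl_castSucc_ne_succ i).symm hx

theorem distMatrix_to_inr
    (hsc : ∀ x y, ∃ l, IsDirectedPath (dC n m) x y l)
    (j : Fin r) (k : Fin (m j)) {x : DCVert n m} (hx : x ≠ .inr ⟨j, k⟩) :
    distMatrix (dC n m) W x (.inr ⟨j, k⟩)
      = distMatrix (dC n m) W x (pathVertex j k.castSucc.castSucc)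
        + ownWeight W j k.castSucc := by
  rw [distMatrix_of_unique_in hsc (adj_to_inr_iff j k)
    (inr_ne_pathVertex_castSucc_castSucc j k) hx, ownWeight, pathVertex_castSucc_succ]

theorem distMatrix_last_inr
    (hsc : ∀ x y, ∃ l, IsDirectedPath (dC n m) x y l) (j : Fin r) (k : Fin (m j)) :
    distMatrix (dC n m) W (.inl (Fin.last n)) (.inr ⟨j, k⟩)
      = prefixSum (ownWeight W j) (k.val + 1) := by
  obtain ⟨k, hk⟩ := k
  induction k with
  | zero =>
    rw [distMatrix_to_inr hsc _ _ (by simp)]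
    have h : pathVertex (n := n) (m := m) j (Fin.castSucc (Fin.castSucc ⟨0, hk⟩))
        = .inl (Fin.last n) := pathVertex_zero j
    rw [h, distMatrix_self]
    exact ((prefixSum_succ (ownWeight W j) 0).trans
      (by rw [Fin.val_zero, prefixSum_zero]; rfl)).symm
  | succ k ih =>
    rw [distMatrix_to_inr hsc _ _ (by simp)]
    have h : pathVertex (n := n) (m := m) j (Fin.castSucc (Fin.castSucc ⟨k + 1, hk⟩))
        = .inr ⟨j, ⟨k, by omega⟩⟩ := pathVertex_succ_castSucc j ⟨k, by omega⟩
    rw [h, ih (by omega)]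
    exact (prefixSum_succ (ownWeight W j) (Fin.castSucc ⟨k + 1, hk⟩)).symm

/-- A path from `u_n` to `u_0` comes in through the last vertex of some `j`-th path and costs `wHat
W j`. The numbers `w W j` and `wHat W j` differ by the common `wc W`, so `j₁` is cheapest. The
ordering of the cycles enters the distances only here; later uses go through this value. -/
theorem distMatrix_last_zero
    (hsc : ∀ x y, ∃ l, IsDirectedPath (dC n m) x y l) (hn : 1 ≤ n) (hm : ∀ j, 1 ≤ m j) {j₁ : Fin r}
    (hj : ∀ j, w W j₁ ≤ w W j) :
    distMatrix (dC n m) W (.inl (Fin.last n)) (.inl 0) = wHat W j₁ := by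
  have hne : Fin.last n ≠ 0 := by
    simp only [ne_eq, Fin.ext_iff, Fin.val_last, Fin.val_zero]
    omega
  have hadj : ∀ j (k : Fin (m j)), k.val + 1 = m j → (dC n m).Adj (.inr ⟨j, k⟩) (.inl 0) :=
    fun j k hk => ⟨hk, rfl⟩
  have hW : ∀ j (k : Fin (m j)), k.val + 1 = m j →
      distMatrix (dC n m) W (.inl (Fin.last n)) (.inr ⟨j, k⟩) + W (.inr ⟨j, k⟩) (.inl 0)
        = wHat W j := by
    intro j k hk
    have h1 := prefixSum_succ (ownWeight W j) k.succ
    rw [prefixSum_of_le _ (by simp [hk]), ownWeight, pathVertex_succ_succ_of_eq j k hk,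
      pathVertex_succ_castSucc] at h1
    rw [distMatrix_last_inr hsc]
    exact h1.symm
  apply le_antisymm
  -- Upper bound: a cheapest path to the last vertex of path `j₁`, extended by `u_0`.
  · have hk : m j₁ - 1 + 1 = m j₁ := by have := hm j₁; omega
    set k : Fin (m j₁) := ⟨m j₁ - 1, by have := hm j₁; omega⟩ with hkdef
    obtain ⟨l, hl, hl'⟩ : distMatrix (dC n m) W (.inl (Fin.last n)) (.inr ⟨j₁, k⟩) ∈
        pathWeights (dC n m) W (.inl (Fin.last n)) (.inr ⟨j₁, k⟩) :=
      (pathWeights_nonempty (hsc _ _)).csInf_mem pathWeights_finite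
    have h0 := inl_zero_notMem hn j₁ k hl
    obtain ⟨l, rfl⟩ := hl.exists_eq_append
    refine (distMatrix_le (isDirectedPath_append_pair_iff.2 ⟨hl, hadj j₁ k hk, rfl, h0⟩)).trans ?_
    rw [pathWeight_append_pair, hl', hW j₁ k hk]
  -- Lower bound: the last step of any path leaves the last vertex of some `j`-th path.
  · refine le_distMatrix (hsc _ _) fun l hl => ?_
    obtain ⟨l, rfl⟩ := hl.exists_eq_append
    rcases List.eq_nil_or_concat l with rfl | ⟨l, b, rfl⟩
    · have := (isDirectedPath_singleton_iff.1 hl).1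
      simp [hne.symm] at this
    · rw [List.concat_eq_append, List.append_assoc, List.singleton_append] at hl ⊢
      obtain ⟨h1, h2, -, -⟩ := isDirectedPath_append_pair_iff.1 hl
      rcases b with q | ⟨j, k⟩
      · simp [dC] at h2
      · have hk : k.val + 1 = m j := h2.1
        have h3 := distMatrix_le (W := W) h1
        have h4 := hW j k hk
        have h5 := hj j
        rw [pathWeight_append_pair]
        unfold w at h5
        linarith

theorem distMatrix_last_inl
    (hsc : ∀ x y, ∃ l, IsDirectedPath (dC n m) x y l) (hn : 1 ≤ n) (hm : ∀ j, 1 ≤ m j) {j₁ : Fin r}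
    (hj : ∀ j, w W j₁ ≤ w W j) (i : Fin n) :
    distMatrix (dC n m) W (.inl (Fin.last n)) (.inl i.castSucc)
      = wHat W j₁ + prefixSum (commonWeight W) i.val := by
  obtain ⟨i, hi⟩ := i
  induction i with
  | zero =>
    rw [prefixSum_zero, add_zero]
    exact distMatrix_last_zero hsc hn hm hj
  | succ i ih =>
    have h1 := prefixSum_succ (commonWeight W) ⟨i, by omega⟩
    simp only at h1 ⊢
    rw [h1, ← add_assoc, ← ih (by omega)]
    refine distMatrix_inl_succ hsc ⟨i, by omega⟩ ?_
    simp only [ne_eq, Sum.inl.injEq, Fin.ext_iff, Fin.val_last, Fin.val_succ]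
    omega

/-- The way from `u_i` to `u_n` is forced as long as the target is not met on it. -/
theorem distMatrix_inl_of_forall_ne
    (hsc : ∀ x y, ∃ l, IsDirectedPath (dC n m) x y l) {y : DCVert n m} (i : Fin (n + 1))
    (hy : ∀ k : Fin n, i ≤ k.castSucc → y ≠ .inl k.castSucc) :
    distMatrix (dC n m) W (.inl i) y + prefixSum (commonWeight W) i.val
      = wc W + distMatrix (dC n m) W (.inl (Fin.last n)) y := by
  induction i using Fin.reverseInduction with
  | last => rw [Fin.val_last, prefixSum_of_le _ le_rfl, add_comm, wc]
  | cast i ih =>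
    rw [← ih fun k hk => hy k ((Fin.castSucc_lt_succ).le.trans hk),
      distMatrix_inl_castSucc hsc i (hy i le_rfl), Fin.val_succ, Fin.val_castSucc, prefixSum_succ]
    ring

theorem distMatrix_inr_of_forall_ne
    (hsc : ∀ x y, ∃ l, IsDirectedPath (dC n m) x y l) {y : DCVert n m} (j : Fin r) (k : Fin (m j))
    (hy : ∀ k' : Fin (m j), k ≤ k' → y ≠ .inr ⟨j, k'⟩) :
    distMatrix (dC n m) W (.inr ⟨j, k⟩) y + prefixSum (ownWeight W j) (k.val + 1)
      = wHat W j + distMatrix (dC n m) W (.inl 0) y := by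
  obtain ⟨t, ht⟩ : ∃ t, k.val + 1 + t = m j := ⟨m j - (k.val + 1), by omega⟩
  have h1 := prefixSum_succ (ownWeight W j) k.succ
  rw [Fin.val_succ] at h1
  induction t generalizing k with
  | zero =>
    rw [prefixSum_of_le _ (by omega)] at h1
    rw [distMatrix_inr hsc j k (hy k le_rfl), pathVertex_succ_succ_of_eq j k (by omega), wHat, h1]
    ring
  | succ t ih =>
    have h2 := ih ⟨k.val + 1, by omega⟩
      (fun k' hk' => hy k' ((Fin.le_def.2 (Nat.le_succ _)).trans hk')) (by simp only; omega)
      (prefixSum_succ (ownWeight W j) (Fin.succ ⟨k.val + 1, by omega⟩))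
    simp only at h2
    rw [distMatrix_inr hsc j k (hy k le_rfl), pathVertex_succ_succ_of_lt j k (by omega), ← h2, h1]
    ring

/-- The way back along an edge of the common path closes the cheapest cycle. -/
theorem distMatrix_inl_succ_castSucc
    (hsc : ∀ x y, ∃ l, IsDirectedPath (dC n m) x y l) (hn : 1 ≤ n) (hm : ∀ j, 1 ≤ m j) {j₁ : Fin r}
    (hj : ∀ j, w W j₁ ≤ w W j) (i : Fin n) :
    distMatrix (dC n m) W (.inl i.succ) (.inl i.castSucc) = w W j₁ - commonWeight W i := by
  have h1 := distMatrix_inl_of_forall_ne (W := W) hsc (y := .inl i.castSucc) i.succ (by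
    intro k hk h
    obtain rfl : i = k := by simpa using h
    exact absurd hk (Fin.castSucc_lt_succ).not_ge)
  rw [distMatrix_last_inl hsc hn hm hj, Fin.val_succ, prefixSum_succ] at h1
  rw [w]
  linarith

/-- A vertex of the `j`-th path can only be reached along that path, so the way back closes the
`j`-th cycle, cheapest or not. -/
theorem distMatrix_pathVertex_inr
    (hsc : ∀ x y, ∃ l, IsDirectedPath (dC n m) x y l) (j : Fin r) (k : Fin (m j)) :
    distMatrix (dC n m) W (pathVertex j k.succ.succ) (.inr ⟨j, k⟩)
      = w W j - ownWeight W j k.succ := by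
  have h0 := distMatrix_inl_of_forall_ne (W := W) hsc (y := .inr ⟨j, k⟩) 0 (by simp)
  rw [Fin.val_zero, prefixSum_zero, distMatrix_last_inr hsc] at h0
  have h1 := prefixSum_succ (ownWeight W j) k.succ
  rw [Fin.val_succ] at h1
  rcases lt_or_eq_of_le (Nat.succ_le_of_lt k.isLt) with h | h
  · have h2 := distMatrix_inr_of_forall_ne (W := W) hsc (y := .inr ⟨j, k⟩) j ⟨k.val + 1, h⟩ (by
      intro k' hk' h
      obtain rfl : k = k' := by simpa using h
      exact absurd (Fin.le_def.1 hk') (by simp))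
    rw [pathVertex_succ_succ_of_lt j k h, w]
    simp only at h2
    linarith
  · rw [prefixSum_of_le _ (by omega)] at h1
    rw [pathVertex_succ_succ_of_eq j k h, w, wHat]
    linarith

/-- Off the diagonal the first step is forced; the diagonal entry is off by a full cycle. Together
with `distMatrix_inr_sub` this reduces all identities for a block to the row of `u_n`. -/
theorem distMatrix_inl_sub
    (hsc : ∀ x y, ∃ l, IsDirectedPath (dC n m) x y l) (hn : 1 ≤ n) (hm : ∀ j, 1 ≤ m j) {j₁ : Fin r}
    (hj : ∀ j, w W j₁ ≤ w W j) (i : Fin n) (y : DCVert n m) :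
    distMatrix (dC n m) W (.inl i.castSucc) y - distMatrix (dC n m) W (.inl i.succ) y
      = commonWeight W i - if y = .inl i.castSucc then w W j₁ else 0 := by
  split_ifs with h
  · rw [h, distMatrix_self, distMatrix_inl_succ_castSucc hsc hn hm hj]
    ring
  · rw [distMatrix_inl_castSucc hsc i h]
    ring

theorem distMatrix_inr_sub
    (hsc : ∀ x y, ∃ l, IsDirectedPath (dC n m) x y l) (j : Fin r) (k : Fin (m j)) (y : DCVert n m) :
    distMatrix (dC n m) W (.inr ⟨j, k⟩) y
        - distMatrix (dC n m) W (pathVertex j k.succ.succ) y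
      = ownWeight W j k.succ - if y = .inr ⟨j, k⟩ then w W j else 0 := by
  split_ifs with h
  · rw [h, distMatrix_self, distMatrix_pathVertex_inr hsc]
    ring
  · rw [distMatrix_inr hsc j k h]
    ring

end DC

/-! ### Inverting a matrix by means of the data `λ, α, β, 𝓛` -/

/-- The identities between a matrix `D` and data `λ, α, β, 𝓛` that determine the inverse of `D`. -/
structure IsLapExpressible {ι : Type*} [Fintype ι] [DecidableEq ι] (D : Matrix ι ι ℝ)
    (B : LapData ι) : Prop where
  sum_β : ∑ x, B.β x = 1
  sum_mul_β : ∀ x, ∑ y, D x y * B.β y = B.lam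
  sum_mul_L : ∀ x y, ∑ z, D x z * B.L z y = B.α y - if x = y then 1 else 0
  row_sum : ∀ x, ∑ y, B.L x y = 0
  col_sum : ∀ y, ∑ x, B.L x y = 0

section Inverse

variable {ι : Type*} [Fintype ι] [DecidableEq ι] {D : Matrix ι ι ℝ} {B : LapData ι}

theorem IsLapExpressible.isLaplacianLike (h : IsLapExpressible D B) : IsLaplacianLike B.L := by
  constructor
  · ext x
    simpa [Matrix.mulVec, dotProduct] using h.row_sum x
  · ext y
    simpa [Matrix.vecMul, dotProduct] using h.col_sum y

theorem IsLapExpressible.mulVec_β (h : IsLapExpressible D B) : D *ᵥ B.β = fun _ => B.lam :=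
  funext h.sum_mul_β

theorem IsLapExpressible.lam_ne_zero (h : IsLapExpressible D B) (hD : D.det ≠ 0) :
    B.lam ≠ 0 := by
  intro h0
  have hβ : B.β = 0 := Matrix.eq_zero_of_mulVec_eq_zero hD (by rw [h.mulVec_β, h0]; rfl)
  simpa [hβ] using h.sum_β

theorem IsLapExpressible.inv_eq (h : IsLapExpressible D B) (hD : D.det ≠ 0) :
    D⁻¹ = -B.L + (1 / B.lam) • Matrix.vecMulVec B.β B.α := by
  have hl := h.lam_ne_zero hD
  refine Matrix.inv_eq_right_inv ?_
  rw [Matrix.mul_add, Matrix.mul_neg, Matrix.mul_smul, Matrix.mul_vecMulVec, h.mulVec_β]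
  ext x y
  have := h.sum_mul_L x y
  simp only [Matrix.add_apply, Matrix.neg_apply, Matrix.smul_apply, Matrix.mul_apply,
    Matrix.vecMulVec_apply, this, smul_eq_mul, Matrix.one_apply]
  field_simp
  ring

/-- The adjugate is applied to `D β = λ 1` and the entries are added up, using `∑ β = 1`. -/
theorem IsLapExpressible.det_eq (h : IsLapExpressible D B) : D.det = B.lam * cof D := by
  have h1 : D.det • B.β = D.adjugate *ᵥ fun _ => B.lam := by
    rw [← h.mulVec_β, Matrix.mulVec_mulVec, Matrix.adjugate_mul, Matrix.smul_mulVec,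
      Matrix.one_mulVec]
  have h2 := congrArg (fun v => ∑ x, v x) h1
  simp only [Pi.smul_apply, smul_eq_mul, ← Finset.mul_sum, h.sum_β, mul_one, Matrix.mulVec,
    dotProduct, ← Finset.sum_mul] at h2
  rw [h2, cof, mul_comm]

/-- If the determinant and the sum of cofactors are non-zero, then the difference of two rows
is not a multiple of the all-ones vector. -/
theorem not_forall_row_sub_eq (hD : D.det ≠ 0) (hc : cof D ≠ 0) {x x' : ι} (hx : x ≠ x') (c : ℝ) :
    ¬ ∀ y, D x y - D x' y = c := by
  intro h
  set e : ι → ℝ := Pi.single x 1 - Pi.single x' 1 with he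
  have h1 : e ᵥ* D = fun _ => c := by
    ext y
    rw [he, Matrix.sub_vecMul]
    simpa using h y
  -- The entries of `e` add up to `0`, so summing this gives `c * cof D = 0`. Hence `c = 0`, and
  -- then `D.det • e = 0`.
  have h2 : D.det • e = (fun _ => c) ᵥ* D.adjugate := by
    rw [← h1, Matrix.vecMul_vecMul, Matrix.mul_adjugate, Matrix.vecMul_smul, Matrix.vecMul_one]
  have h3 : c * cof D = 0 := by
    have := congrArg (fun v => ∑ y, v y) h2
    simp only [Pi.smul_apply, smul_eq_mul, ← Finset.mul_sum, Matrix.vecMul, dotProduct] at this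
    rw [show cof D = ∑ i, ∑ j, D.adjugate j i from Finset.sum_comm, ← this]
    simp [he, Finset.sum_sub_distrib]
  obtain rfl := (mul_eq_zero.1 h3).resolve_right hc
  have h4 : D.det • e = 0 := by
    rw [h2]
    exact Matrix.zero_vecMul _
  have h5 := congrFun h4 x
  simp [he, hx, hD] at h5

theorem IsLapExpressible.reindex {κ : Type*} [Fintype κ] [DecidableEq κ] (e : ι ≃ κ)
    {D' : Matrix κ κ ℝ} {B' : LapData κ} (h : IsLapExpressible D B)
    (hD : ∀ x y, D' (e x) (e y) = D x y) (hlam : B'.lam = B.lam) (hα : ∀ x, B'.α (e x) = B.α x)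
    (hβ : ∀ x, B'.β (e x) = B.β x) (hL : ∀ x y, B'.L (e x) (e y) = B.L x y) :
    IsLapExpressible D' B' where
  sum_β := by
    rw [← e.sum_comp]
    simpa only [hβ] using h.sum_β
  sum_mul_β x := by
    obtain ⟨x, rfl⟩ := e.surjective x
    rw [← e.sum_comp]
    simpa only [hβ, hD, hlam] using h.sum_mul_β x
  sum_mul_L x y := by
    obtain ⟨x, rfl⟩ := e.surjective x
    obtain ⟨y, rfl⟩ := e.surjective y
    rw [← e.sum_comp]
    simpa only [hD, hL, hα, e.injective.eq_iff] using h.sum_mul_L x y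
  row_sum x := by
    obtain ⟨x, rfl⟩ := e.surjective x
    rw [← e.sum_comp]
    simpa only [hL] using h.row_sum x
  col_sum x := by
    obtain ⟨x, rfl⟩ := e.surjective x
    rw [← e.sum_comp]
    simpa only [hL] using h.col_sum x

end Inverse

namespace DC

variable {n r : ℕ} {m : Fin r → ℕ} {W : DCVert n m → DCVert n m → ℝ} {j₁ : Fin r}

/-! ### The data of `dC(n; m₁, …, m_r)` -/

theorem alpha_zero : alpha W j₁ (.inl 0) = ∑ j, ownWeight W j (Fin.last (m j)) / w W j
    - ∑ j ∈ Finset.univ.erase j₁, wHat W j / w W j := rfl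

theorem alpha_succ (i : Fin n) : alpha W j₁ (.inl i.succ) = commonWeight W i / w W j₁ := rfl

theorem alpha_inr (j : Fin r) (k : Fin (m j)) :
    alpha W j₁ (.inr ⟨j, k⟩) = ownWeight W j k.castSucc / w W j := rfl

theorem beta_last : beta W j₁ (.inl (Fin.last n)) = ∑ j, ownWeight W j 0 / w W j
    - ∑ j ∈ Finset.univ.erase j₁, wHat W j / w W j :=
  Fin.lastCases_last (motive := fun _ => ℝ)

theorem beta_castSucc (i : Fin n) :
    beta W j₁ (.inl i.castSucc) = commonWeight W i / w W j₁ :=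
  Fin.lastCases_castSucc (motive := fun _ => ℝ) ..

theorem beta_inr (j : Fin r) (k : Fin (m j)) :
    beta W j₁ (.inr ⟨j, k⟩) = ownWeight W j k.succ / w W j := rfl

theorem adj_castSucc_left (i : Fin n) (y : DCVert n m) :
    adj W j₁ (.inl i.castSucc) y = if y = .inl i.succ then 1 / w W j₁ else 0 := by
  simp only [adj, Matrix.of_apply, adj_inl_castSucc_iff]
  split_ifs with h
  · rw [h]
  · rfl

theorem adj_inr_left (j : Fin r) (k : Fin (m j)) (y : DCVert n m) :
    adj W j₁ (.inr ⟨j, k⟩) y = if y = pathVertex j k.succ.succ then 1 / w W j else 0 := by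
  simp only [adj, Matrix.of_apply, adj_inr_iff]

theorem adj_succ_right (i : Fin n) (x : DCVert n m) :
    adj W j₁ x (.inl i.succ) = if x = .inl i.castSucc then 1 / w W j₁ else 0 := by
  simp only [adj, Matrix.of_apply, adj_inl_succ_iff]
  split_ifs with h
  · rw [h]
  · rfl

theorem adj_inr_right (j : Fin r) (k : Fin (m j)) (x : DCVert n m) :
    adj W j₁ x (.inr ⟨j, k⟩)
      = if x = pathVertex j k.castSucc.castSucc then 1 / w W j else 0 := by
  by_cases h : (dC n m).Adj x (.inr ⟨j, k⟩)
  · rw [if_pos ((adj_to_inr_iff j k x).1 h)]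
    simp only [adj, Matrix.of_apply, if_pos h]
    rcases x with q | ⟨l, i⟩
    · rfl
    · obtain rfl : l = j := h.1
      rfl
  · rw [if_neg fun h' => h ((adj_to_inr_iff j k x).2 h')]
    simp only [adj, Matrix.of_apply, if_neg h]

theorem sum_adj_castSucc (i : Fin n) : ∑ y, adj W j₁ (.inl i.castSucc) y = 1 / w W j₁ := by
  simp [adj_castSucc_left]

theorem sum_adj_inr (j : Fin r) (k : Fin (m j)) :
    ∑ y, adj W j₁ (.inr ⟨j, k⟩) y = 1 / w W j := by
  simp [adj_inr_left]

theorem sum_adj_last (hm : ∀ j, 1 ≤ m j) :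
    ∑ y, adj W j₁ (.inl (Fin.last n)) y = ∑ j, 1 / w W j := by
  rw [Fintype.sum_sum_type, Fintype.sum_sigma]
  have h1 : ∀ q, adj W j₁ (.inl (Fin.last n)) (.inl q) = 0 := by
    intro q
    simp [adj, dC, q.isLt.ne]
  have h2 : ∀ j (k : Fin (m j)), adj W j₁ (.inl (Fin.last n)) (.inr ⟨j, k⟩)
      = if k = ⟨0, hm j⟩ then 1 / w W j else 0 := by
    intro j k
    have h3 : (dC n m).Adj (.inl (Fin.last n)) (.inr ⟨j, k⟩) ↔ k = ⟨0, hm j⟩ := by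
      simp only [dC, Fin.ext_iff, Fin.val_last, true_and]
    simp only [adj, Matrix.of_apply, h3]
  simp [h1, h2]

theorem sum_mul_adj_zero (hm : ∀ j, 1 ≤ m j) (g : DCVert n m → ℝ) :
    ∑ z, g z * adj W j₁ z (.inl 0)
      = ∑ j, g (.inr ⟨j, ⟨m j - 1, Nat.sub_lt (hm j) one_pos⟩⟩) * (1 / w W j) := by
  rw [Fintype.sum_sum_type, Fintype.sum_sigma]
  have h1 : ∀ q : Fin (n + 1), adj W j₁ (.inl q) (.inl 0) = 0 := by
    intro q
    simp [adj, dC]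
  have h2 : ∀ j (k : Fin (m j)), adj W j₁ (.inr ⟨j, k⟩) (.inl 0)
      = if k = ⟨m j - 1, Nat.sub_lt (hm j) one_pos⟩ then 1 / w W j else 0 := by
    intro j k
    have h3 : (dC n m).Adj (.inr ⟨j, k⟩) (.inl 0)
        ↔ k = ⟨m j - 1, Nat.sub_lt (hm j) one_pos⟩ := by
      have := hm j
      simp only [dC, Fin.ext_iff, Fin.val_zero, and_true]
      omega
    simp only [adj, Matrix.of_apply, h3]
  simp [h1, h2]

theorem sum_mul_adj_succ (g : DCVert n m → ℝ) (i : Fin n) :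
    ∑ z, g z * adj W j₁ z (.inl i.succ) = g (.inl i.castSucc) * (1 / w W j₁) := by
  simp only [adj_succ_right, mul_ite, mul_zero, Finset.sum_ite_eq', Finset.mem_univ, if_true]

theorem sum_mul_adj_inr (g : DCVert n m → ℝ) (j : Fin r) (k : Fin (m j)) :
    ∑ z, g z * adj W j₁ z (.inr ⟨j, k⟩)
      = g (pathVertex j k.castSucc.castSucc) * (1 / w W j) := by
  simp only [adj_inr_right, mul_ite, mul_zero, Finset.sum_ite_eq', Finset.mem_univ, if_true]

theorem perturbation_of_ne {x : DCVert n m} (hx : x ≠ .inl (Fin.last n)) (y : DCVert n m) :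
    perturbation W j₁ x y = 0 := by
  simp [perturbation, hx]

theorem perturbation_last_zero :
    perturbation W j₁ (.inl (Fin.last n)) (.inl 0) = ∑ j ∈ Finset.univ.erase j₁, 1 / w W j := by
  simp [perturbation]

theorem perturbation_last_last (hn : 1 ≤ n) :
    perturbation W j₁ (.inl (Fin.last n)) (.inl (Fin.last n))
      = -∑ j ∈ Finset.univ.erase j₁, 1 / w W j := by
  have : Fin.last n ≠ 0 := by
    simp only [ne_eq, Fin.ext_iff, Fin.val_last, Fin.val_zero]
    omega
  simp [perturbation, this]

theorem perturbation_last_of_ne {y : DCVert n m} (h0 : y ≠ .inl 0) (hn : y ≠ .inl (Fin.last n)) :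
    perturbation W j₁ (.inl (Fin.last n)) y = 0 := by
  simp [perturbation, h0, hn]

theorem sum_mul_lap (g : DCVert n m → ℝ) (y : DCVert n m) :
    ∑ z, g z * lap W j₁ z y = g y * ∑ z, adj W j₁ y z - ∑ z, g z * adj W j₁ z y
      + g (.inl (Fin.last n)) * perturbation W j₁ (.inl (Fin.last n)) y := by
  simp only [lap, Matrix.add_apply, Matrix.sub_apply, mul_add, mul_sub, Finset.sum_add_distrib,
    Finset.sum_sub_distrib]
  congr 1
  · congr 1
    simp [Matrix.diagonal_apply]
  · refine Finset.sum_eq_single _ (fun z _ hz => ?_) (by simp)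
    rw [perturbation_of_ne hz, mul_zero]

/-- Away from `u_n` there is no perturbation, and the row of `𝓛` matches the row differences of the
distance matrix. -/
theorem lap_castSucc (i : Fin n) (y : DCVert n m) :
    lap W j₁ (.inl i.castSucc) y = ((if y = .inl i.castSucc then 1 else 0)
      - if y = .inl i.succ then 1 else 0) / w W j₁ := by
  have h : (.inl i.castSucc : DCVert n m) ≠ .inl (Fin.last n) := by
    simp [i.castSucc_lt_last.ne]
  simp only [lap, Matrix.add_apply, Matrix.sub_apply, perturbation_of_ne h, add_zero,
    Matrix.diagonal_apply, sum_adj_castSucc]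
  rw [adj_castSucc_left]
  simp only [eq_comm (a := y)]
  split_ifs <;> ring

theorem lap_inr (j : Fin r) (k : Fin (m j)) (y : DCVert n m) :
    lap W j₁ (.inr ⟨j, k⟩) y = ((if y = .inr ⟨j, k⟩ then 1 else 0)
      - if y = pathVertex j k.succ.succ then 1 else 0) / w W j := by
  simp only [lap, Matrix.add_apply, Matrix.sub_apply, perturbation_of_ne Sum.inr_ne_inl, add_zero,
    Matrix.diagonal_apply, sum_adj_inr]
  rw [adj_inr_left]
  simp only [eq_comm (a := y)]
  split_ifs <;> ring

theorem sum_lap_row (hn : 1 ≤ n) (x : DCVert n m) : ∑ y, lap W j₁ x y = 0 := by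
  simp only [lap, Matrix.add_apply, Matrix.sub_apply, Finset.sum_add_distrib,
    Finset.sum_sub_distrib]
  have h1 : ∑ y, Matrix.diagonal (fun x => ∑ y, adj W j₁ x y) x y = ∑ y, adj W j₁ x y := by
    simp [Matrix.diagonal_apply]
  have h2 : ∑ y, perturbation W j₁ x y = 0 := by
    by_cases hx : x = .inl (Fin.last n)
    · subst hx
      have hne : (.inl 0 : DCVert n m) ≠ .inl (Fin.last n) := by
        simp only [ne_eq, Sum.inl.injEq, Fin.ext_iff, Fin.val_last, Fin.val_zero]
        omega
      rw [Fintype.sum_eq_add _ _ hne fun y hy => perturbation_last_of_ne hy.1 hy.2,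
        perturbation_last_zero, perturbation_last_last hn, add_neg_cancel]
    · simp [perturbation_of_ne hx]
  rw [h1, h2, sub_self, add_zero]

theorem sum_one_div_w : ∑ j, 1 / w W j - 1 / w W j₁ = ∑ j ∈ Finset.univ.erase j₁, 1 / w W j := by
  rw [← Finset.add_sum_erase _ _ (Finset.mem_univ j₁), add_sub_cancel_left]

/-- The vertices of `dC(n; m₁, …, m_r)`: `u_0`, `u_n`, the inner vertices of the common path, and
the vertices of the other paths. -/
theorem vertex_cases {motive : DCVert n m → Prop} (zero : motive (.inl 0))
    (last : motive (.inl (Fin.last n)))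
    (inner : ∀ i k : Fin n, i.succ = k.castSucc → motive (.inl i.succ))
    (inr : ∀ j k, motive (.inr ⟨j, k⟩)) (x : DCVert n m) : motive x := by
  rcases x with i | ⟨j, k⟩
  · by_cases h0 : i = 0
    · exact h0 ▸ zero
    · by_cases h1 : i = Fin.last n
      · exact h1 ▸ last
      · obtain ⟨i, rfl⟩ := Fin.exists_succ_eq.2 h0
        obtain ⟨k, hk⟩ := Fin.exists_castSucc_eq.2 h1
        exact inner i k hk.symm
  · exact inr j k

theorem inner_ne_zero (i : Fin n) : (.inl i.succ : DCVert n m) ≠ .inl 0 := by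
  simp [Fin.succ_ne_zero]

theorem inner_ne_last {i k : Fin n} (h : i.succ = k.castSucc) :
    (.inl i.succ : DCVert n m) ≠ .inl (Fin.last n) := by
  rw [h]
  simp [k.castSucc_lt_last.ne]

/-- Products `gᵀ 𝓛` are computed column by column for arbitrary `g`: the choice `g = 1` gives the
column sums, a row of `D` gives `D 𝓛`. In this column the perturbation makes up for `u_0` having `r`
in-neighbours but only one out-neighbour. -/
theorem sum_mul_lap_zero (hn : 1 ≤ n) (hm : ∀ j, 1 ≤ m j) (g : DCVert n m → ℝ) :
    ∑ z, g z * lap W j₁ z (.inl 0) = g (.inl 0) * (1 / w W j₁)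
      - ∑ j, g (.inr ⟨j, ⟨m j - 1, Nat.sub_lt (hm j) one_pos⟩⟩) * (1 / w W j)
      + g (.inl (Fin.last n)) * ∑ j ∈ Finset.univ.erase j₁, 1 / w W j := by
  rw [sum_mul_lap, sum_mul_adj_zero hm, perturbation_last_zero]
  congr 3
  exact sum_adj_castSucc (⟨0, hn⟩ : Fin n)

/-- The perturbation cuts the out-degree `∑ 1 / w_j` of `u_n` down to `1 / w_1`, which is its
in-degree. -/
theorem sum_mul_lap_last (hn : 1 ≤ n) (hm : ∀ j, 1 ≤ m j) (g : DCVert n m → ℝ) :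
    ∑ z, g z * lap W j₁ z (.inl (Fin.last n)) = (g (.inl (Fin.last n))
      - g (.inl (Fin.castSucc ⟨n - 1, Nat.sub_lt hn one_pos⟩))) * (1 / w W j₁) := by
  have h : Fin.last n = Fin.succ ⟨n - 1, Nat.sub_lt hn one_pos⟩ := by
    ext
    simp only [Fin.val_last, Fin.val_succ]
    omega
  have h1 : ∑ z, g z * adj W j₁ z (.inl (Fin.last n))
      = g (.inl (Fin.castSucc ⟨n - 1, Nat.sub_lt hn one_pos⟩)) * (1 / w W j₁) := by
    rw [h]
    exact sum_mul_adj_succ g _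
  rw [sum_mul_lap, perturbation_last_last hn, h1, sum_adj_last hm, ← sum_one_div_w]
  ring

theorem sum_mul_lap_inner {i k : Fin n} (h : i.succ = k.castSucc) (g : DCVert n m → ℝ) :
    ∑ z, g z * lap W j₁ z (.inl i.succ)
      = (g (.inl i.succ) - g (.inl i.castSucc)) * (1 / w W j₁) := by
  rw [sum_mul_lap, perturbation_last_of_ne (inner_ne_zero i) (inner_ne_last h),
    sum_mul_adj_succ, h, sum_adj_castSucc]
  ring

theorem sum_mul_lap_inr (j : Fin r) (k : Fin (m j)) (g : DCVert n m → ℝ) :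
    ∑ z, g z * lap W j₁ z (.inr ⟨j, k⟩)
      = (g (.inr ⟨j, k⟩) - g (pathVertex j k.castSucc.castSucc)) * (1 / w W j) := by
  rw [sum_mul_lap, perturbation_last_of_ne Sum.inr_ne_inl Sum.inr_ne_inl, sum_mul_adj_inr,
    sum_adj_inr]
  ring

theorem sum_lap_col (hn : 1 ≤ n) (hm : ∀ j, 1 ≤ m j) (y : DCVert n m) :
    ∑ x, lap W j₁ x y = 0 := by
  have h : ∑ z, (fun _ => (1 : ℝ)) z * lap W j₁ z y = 0 := by
    induction y using vertex_cases with
    | zero =>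
      rw [sum_mul_lap_zero hn hm, ← sum_one_div_w]
      simp only [one_mul]
      ring
    | last => rw [sum_mul_lap_last hn hm, sub_self, zero_mul]
    | inner i k h => rw [sum_mul_lap_inner h, sub_self, zero_mul]
    | inr j k => rw [sum_mul_lap_inr, sub_self, zero_mul]
  simpa using h

/-- The common path contributes `1 - ŵ_1 / w_1` and each remaining path, with its share of `β(u_n)`,
contributes `ŵ_j / w_j`. The correction in `β(u_n)` cancels the terms with `j ≠ j₁`. -/
theorem sum_beta (hw : ∀ j, w W j ≠ 0) : ∑ x, beta W j₁ x = 1 := by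
  rw [Fintype.sum_sum_type, Fintype.sum_sigma, Fin.sum_univ_castSucc]
  simp only [beta_castSucc, beta_last, beta_inr]
  have h1 : ∀ j, ∑ k : Fin (m j), ownWeight W j k.succ / w W j
      = wHat W j / w W j - ownWeight W j 0 / w W j := by
    intro j
    rw [wHat, Fin.sum_univ_succ, ← Finset.sum_div]
    ring
  have h2 : ∑ i, commonWeight W i / w W j₁ = 1 - wHat W j₁ / w W j₁ := by
    rw [← Finset.sum_div]
    change wc W / w W j₁ = _
    have := hw j₁
    field_simp
    rw [w]
    ring
  rw [h2]
  simp only [h1, Finset.sum_sub_distrib]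
  rw [← Finset.add_sum_erase _ (fun j => wHat W j / w W j) (Finset.mem_univ j₁)]
  ring

/-- The difference of two rows along an edge, applied to `β`, is `W - w * (W / w) = 0`. The common
value is computed in row `u_n`, where the irregular entry `β(u_n)` is multiplied by `0`. -/
theorem sum_distMatrix_mul_beta
    (hsc : ∀ x y, ∃ l, IsDirectedPath (dC n m) x y l) (hn : 1 ≤ n) (hm : ∀ j, 1 ≤ m j)
    (hj : ∀ j, w W j₁ ≤ w W j) (hw : ∀ j, w W j ≠ 0) (x : DCVert n m) :
    ∑ y, distMatrix (dC n m) W x y * beta W j₁ y = lam W j₁ := by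
  rw [eq_of_succ (f := fun x => ∑ y, distMatrix (dC n m) W x y * beta W j₁ y) _ _ x]
  · rw [Fintype.sum_sum_type, Fintype.sum_sigma, Fin.sum_univ_castSucc]
    simp only [beta_castSucc, beta_inr, distMatrix_last_inr hsc, distMatrix_last_inl hsc hn hm hj,
      distMatrix_self, zero_mul, add_zero]
    have h1 : ∀ j, ∑ k : Fin (m j), prefixSum (ownWeight W j) (k.val + 1)
        * (ownWeight W j k.succ / w W j) = pairSum (ownWeight W j) / w W j := by
      intro j
      rw [pairSum_eq, Fin.sum_univ_succ, Fin.val_zero, prefixSum_zero, zero_mul, zero_add,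
        Finset.sum_div]
      exact Finset.sum_congr rfl fun k _ => by rw [Fin.val_succ, mul_div_assoc]
    simp only [h1]
    rw [lam, pairSum_eq (commonWeight W), wc, Finset.sum_mul, Finset.sum_div, Finset.sum_div,
      ← Finset.sum_add_distrib]
    congr 1
    exact Finset.sum_congr rfl fun i _ => by ring
  · intro i
    rw [← sub_eq_zero, ← Finset.sum_sub_distrib]
    simp only [← sub_mul, distMatrix_inl_sub hsc hn hm hj]
    simp only [sub_mul, Finset.sum_sub_distrib, ← Finset.mul_sum, sum_beta hw, ite_mul, zero_mul,
      Finset.sum_ite_eq', Finset.mem_univ, if_true, beta_castSucc]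
    have := hw j₁
    field_simp
    ring
  · intro j k
    rw [← sub_eq_zero, ← Finset.sum_sub_distrib]
    simp only [← sub_mul, distMatrix_inr_sub hsc]
    simp only [sub_mul, Finset.sum_sub_distrib, ← Finset.mul_sum, sum_beta hw, ite_mul, zero_mul,
      Finset.sum_ite_eq', Finset.mem_univ, if_true, beta_inr]
    have := hw j
    field_simp
    ring

/-- Along an edge `x → x'` the change of `D 𝓛 + I` is `W 1ᵀ 𝓛 - w 𝓛_x + e_xᵀ - e_{x'}ᵀ`, which
vanishes by the column sums and the shape of row `x` of `𝓛`. In row `u_n` the columns give `α`. -/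
theorem sum_distMatrix_mul_lap
    (hsc : ∀ x y, ∃ l, IsDirectedPath (dC n m) x y l) (hn : 1 ≤ n) (hm : ∀ j, 1 ≤ m j)
    (hj : ∀ j, w W j₁ ≤ w W j) (hw : ∀ j, w W j ≠ 0) (x y : DCVert n m) :
    ∑ z, distMatrix (dC n m) W x z * lap W j₁ z y = alpha W j₁ y - if x = y then 1 else 0 := by
  rw [eq_sub_iff_add_eq,
    eq_of_succ (f := fun x => ∑ z, distMatrix (dC n m) W x z * lap W j₁ z y
      + if x = y then 1 else 0) _ _ x]
  · induction y using vertex_cases with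
    | zero =>
      have hne : (.inl (Fin.last n) : DCVert n m) ≠ .inl 0 := by
        simp only [ne_eq, Sum.inl.injEq, Fin.ext_iff, Fin.val_last, Fin.val_zero]
        omega
      rw [sum_mul_lap_zero hn hm, if_neg hne, distMatrix_self, distMatrix_last_zero hsc hn hm hj,
        alpha_zero]
      have h1 : ∀ j, distMatrix (dC n m) W (.inl (Fin.last n))
          (.inr ⟨j, ⟨m j - 1, Nat.sub_lt (hm j) one_pos⟩⟩) * (1 / w W j)
          = wHat W j / w W j - ownWeight W j (Fin.last (m j)) / w W j := by
        intro j
        have h2 := prefixSum_succ (ownWeight W j) (Fin.last (m j))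
        rw [Fin.val_last, prefixSum_of_le _ le_rfl] at h2
        rw [distMatrix_last_inr hsc, wHat, h2]
        simp only [Nat.sub_add_cancel (hm j)]
        ring
      simp only [h1, Finset.sum_sub_distrib]
      rw [← Finset.add_sum_erase _ (fun j => wHat W j / w W j) (Finset.mem_univ j₁)]
      ring
    | last =>
      have h : Fin.last n = Fin.succ ⟨n - 1, Nat.sub_lt hn one_pos⟩ := by
        ext
        simp only [Fin.val_last, Fin.val_succ]
        omega
      -- The distance from `u_n` back to `u_{n-1}` is `w_1 - W_n`; its term `w_1` balances the
      -- diagonal `1`.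
      have h1 := distMatrix_inl_succ_castSucc (W := W) hsc hn hm hj ⟨n - 1, Nat.sub_lt hn one_pos⟩
      have h2 := alpha_succ (W := W) (j₁ := j₁) (⟨n - 1, Nat.sub_lt hn one_pos⟩ : Fin n)
      rw [← h] at h1 h2
      rw [sum_mul_lap_last hn hm, if_pos rfl, distMatrix_self, h1, h2]
      have := hw j₁
      field_simp
      ring
    | inner i k h =>
      rw [sum_mul_lap_inner h, if_neg (inner_ne_last h).symm,
        distMatrix_inl_succ hsc i (inner_ne_last h).symm, alpha_succ]
      ring
    | inr j k =>
      rw [sum_mul_lap_inr, if_neg Sum.inl_ne_inr, distMatrix_to_inr hsc j k Sum.inl_ne_inr,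
        alpha_inr]
      ring
  · intro i
    rw [← sub_eq_zero, add_sub_add_comm, ← Finset.sum_sub_distrib]
    simp only [← sub_mul, distMatrix_inl_sub hsc hn hm hj]
    simp only [sub_mul, Finset.sum_sub_distrib, ← Finset.mul_sum, sum_lap_col hn hm, ite_mul,
      zero_mul, Finset.sum_ite_eq', Finset.mem_univ, if_true, lap_castSucc, eq_comm (a := y)]
    have := hw j₁
    field_simp
    ring
  · intro j k
    rw [← sub_eq_zero, add_sub_add_comm, ← Finset.sum_sub_distrib]
    simp only [← sub_mul, distMatrix_inr_sub hsc]
    simp only [sub_mul, Finset.sum_sub_distrib, ← Finset.mul_sum, sum_lap_col hn hm, ite_mul,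
      zero_mul, Finset.sum_ite_eq', Finset.mem_univ, if_true, lap_inr, eq_comm (a := y)]
    have := hw j
    field_simp
    ring

theorem isLapExpressible
    (hsc : ∀ x y, ∃ l, IsDirectedPath (dC n m) x y l) (hn : 1 ≤ n) (hm : ∀ j, 1 ≤ m j)
    (hj : ∀ j, w W j₁ ≤ w W j) (hw : ∀ j, w W j ≠ 0) :
    IsLapExpressible (distMatrix (dC n m) W) ⟨lam W j₁, alpha W j₁, beta W j₁, lap W j₁⟩ where
  sum_β := sum_beta hw
  sum_mul_β := sum_distMatrix_mul_beta hsc hn hm hj hw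
  sum_mul_L := sum_distMatrix_mul_lap hsc hn hm hj hw
  row_sum := sum_lap_row hn
  col_sum := sum_lap_col hn hm

/-- If `w_j = 0`, the rows of `v_1^{(j)}` and its out-neighbour differ by a constant. -/
theorem w_ne_zero
    (hsc : ∀ x y, ∃ l, IsDirectedPath (dC n m) x y l)
    (hm : ∀ j, 1 ≤ m j) (hdet : (distMatrix (dC n m) W).det ≠ 0)
    (hcof : cof (distMatrix (dC n m) W) ≠ 0) (j : Fin r) : w W j ≠ 0 := by
  intro h0
  set k : Fin (m j) := ⟨0, hm j⟩
  refine not_forall_row_sub_eq hdet hcof (inr_ne_pathVertex_succ_succ j k)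
    (ownWeight W j k.succ) fun y => ?_
  rw [distMatrix_inr_sub hsc, h0, ite_self, sub_zero]

end DC

/-! ### Presentations of blocks -/

theorem cof_submatrix_equiv_self {ι κ : Type*} [Fintype ι] [DecidableEq ι] [Fintype κ]
    [DecidableEq κ] (e : κ ≃ ι) (A : Matrix ι ι ℝ) : cof (A.submatrix e e) = cof A := by
  simp only [cof, Matrix.adjugate_submatrix_equiv_self, Matrix.submatrix_apply]
  rw [← e.sum_comp fun i => ∑ j, A.adjugate i j]
  exact Finset.sum_congr rfl fun i _ => e.sum_comp (A.adjugate (e i))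

namespace DCPresentation

section Transport

variable {U : Type*} {G : Digraph U} (P : DCPresentation G) (W : U → U → ℝ)

theorem distMatrix_iso (x y : DCVert P.n P.m) :
    distMatrix G W (P.iso x) (P.iso y) = distMatrix (dC P.n P.m) (P.weight W) x y :=
  distMatrix_map P.iso.injective (fun _ _ => P.iso.map_rel_iff.symm) fun _ _ c _ =>
    P.iso.surjective c

theorem exists_isDirectedPath (hsc : ∀ x y, ∃ l, IsDirectedPath G x y l)
    (x y : DCVert P.n P.m) : ∃ l, IsDirectedPath (dC P.n P.m) x y l := by
  obtain ⟨l, hl⟩ := hsc (P.iso x) (P.iso y)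
  obtain ⟨l, rfl⟩ := (List.map_surjective_iff.2 P.iso.surjective) l
  exact ⟨l, (isDirectedPath_map_iff P.iso.injective fun _ _ => P.iso.map_rel_iff.symm).1 hl⟩

theorem isLapExpressible [Fintype U] [DecidableEq U] (hsc : ∀ x y, ∃ l, IsDirectedPath G x y l)
    (hdet : (distMatrix G W).det ≠ 0) (hcof : cof (distMatrix G W) ≠ 0) (hP : P.IsOrdered W) :
    IsLapExpressible (distMatrix G W) (P.lapData W) := by
  have hsub : distMatrix (dC P.n P.m) (P.weight W)
      = (distMatrix G W).submatrix P.iso.toEquiv P.iso.toEquiv := by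
    ext x y
    exact (P.distMatrix_iso W x y).symm
  have hsc' := P.exists_isDirectedPath hsc
  have hw := DC.w_ne_zero (W := P.weight W) hsc' P.one_le_m
    (by rwa [hsub, Matrix.det_submatrix_equiv_self])
    (by rwa [hsub, cof_submatrix_equiv_self])
  refine (DC.isLapExpressible (j₁ := P.first) hsc' P.one_le_n P.one_le_m
    (fun j => hP (Fin.mk_le_of_le_val (Nat.zero_le _))) hw).reindex P.iso.toEquiv
    (P.distMatrix_iso W) rfl ?_ ?_ ?_
  · exact fun x => congrArg (DC.alpha (P.weight W) P.first) (P.iso.symm_apply_apply x)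
  · exact fun x => congrArg (DC.beta (P.weight W) P.first) (P.iso.symm_apply_apply x)
  · exact fun x y =>
      congrArg₂ (DC.lap (P.weight W) P.first) (P.iso.symm_apply_apply x) (P.iso.symm_apply_apply y)

end Transport

end DCPresentation

section Reorder

variable {n r : ℕ} (m : Fin r → ℕ) (σ : Equiv.Perm (Fin r))

/-- The bijection of vertices that renumbers the cycles. -/
def reorderEquiv : DCVert n (m ∘ σ) ≃ DCVert n m :=
  Equiv.sumCongr (Equiv.refl _) (Equiv.sigmaCongrLeft (β := fun j => Fin (m j)) σ)

theorem reorderEquiv_adj_iff (x y : DCVert n (m ∘ σ)) :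
    (dC n m).Adj (reorderEquiv m σ x) (reorderEquiv m σ y) ↔ (dC n (m ∘ σ)).Adj x y := by
  rcases x with p | ⟨j, i⟩ <;> rcases y with q | ⟨l, k⟩
  · rfl
  · rfl
  · rfl
  · exact and_congr_left' σ.injective.eq_iff

theorem reorderEquiv_pathVertex (j : Fin r) (i : Fin (m (σ j) + 2)) :
    reorderEquiv (n := n) m σ (DC.pathVertex (m := m ∘ σ) j i) = DC.pathVertex (σ j) i := by
  induction i using Fin.cases with
  | zero => rfl
  | succ i =>
    induction i using Fin.lastCases with
    | last =>
      exact (congrArg (reorderEquiv m σ) (DC.pathVertex_last (m := m ∘ σ) j)).trans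
        (DC.pathVertex_last (σ j)).symm
    | cast i =>
      exact (congrArg (reorderEquiv m σ) (DC.pathVertex_castSucc_succ (m := m ∘ σ) j i)).trans
        (DC.pathVertex_castSucc_succ (σ j) i).symm

/-- The presentation with renumbered cycles. -/
def DCPresentation.reorder {U : Type*} {G : Digraph U} (P : DCPresentation G)
    (σ : Equiv.Perm (Fin P.r)) : DCPresentation G where
  n := P.n
  r := P.r
  m := P.m ∘ σ
  one_le_n := P.one_le_n
  one_le_r := P.one_le_r
  one_le_m j := P.one_le_m (σ j)
  iso := RelIso.trans ⟨reorderEquiv P.m σ, reorderEquiv_adj_iff P.m σ _ _⟩ P.iso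

theorem DCPresentation.w_reorder {U : Type*} {G : Digraph U} (P : DCPresentation G)
    (W : U → U → ℝ) (σ : Equiv.Perm (Fin P.r)) (j : Fin P.r) :
    DC.w ((P.reorder σ).weight W) j = DC.w (P.weight W) (σ j) := by
  have h : ∀ i, DC.ownWeight ((P.reorder σ).weight W) j i
      = DC.ownWeight (P.weight W) (σ j) i := fun i =>
    congrArg₂ (P.weight W) (reorderEquiv_pathVertex P.m σ j i.castSucc)
      (reorderEquiv_pathVertex P.m σ j i.succ)
  exact congrArg (DC.wc (P.weight W) + ·) (Finset.sum_congr rfl fun i _ => h i)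

theorem DCPresentation.exists_isOrdered {U : Type*} {G : Digraph U} (P : DCPresentation G)
    (W : U → U → ℝ) : ∃ P' : DCPresentation G, P'.IsOrdered W := by
  refine ⟨P.reorder (Tuple.sort (DC.w (P.weight W))), fun i j hij => ?_⟩
  exact (P.w_reorder W _ i).trans_le ((Tuple.monotone_sort (DC.w (P.weight W)) hij).trans_eq
    (P.w_reorder W _ j).symm)

end Reorder

/-! ### Composition of the data of the blocks -/

theorem connected_of_exists_isDirectedPath {V : Type*} [Nonempty V]
    {G : Digraph V}
    (hsc : ∀ x y, ∃ l, IsDirectedPath G x y l) : G.toSimpleGraphInclusive.Connected := by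
  refine (SimpleGraph.connected_iff _).2 ⟨fun x y => ?_, inferInstance⟩
  obtain ⟨l, hl⟩ := hsc x y
  obtain ⟨p, -⟩ := hl.reachableIn (A := Set.univ) fun _ _ => trivial
  exact ⟨p⟩

section Composition

variable {V : Type*} [Fintype V] [DecidableEq V] {G : Digraph V}

theorem sum_dite_mem (S : Finset V) (f : S → ℝ) :
    ∑ z, (if h : z ∈ S then f ⟨z, h⟩ else 0) = ∑ z : S, f z := by
  rw [← Finset.sum_subset S.subset_univ fun z _ hz => dif_neg hz, ← Finset.sum_attach]
  exact Finset.sum_congr rfl fun z _ => dif_pos z.2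

/-- The quantity `β - 1` is additive over blocks; this form absorbs the block index. -/
theorem composition_β (B : ∀ t : Block G, LapData t.1) (v : V) : (composition G B).β v
    = 1 + ∑ t : Block G, if h : v ∈ t.1 then (B t).β ⟨v, h⟩ - 1 else 0 := by
  have h : (blockIndex G v : ℝ) = ∑ t : Block G, if v ∈ t.1 then 1 else 0 := by
    rw [blockIndex, Nat.card_eq_fintype_card, Fintype.card_subtype]
    simp
  have h' : (composition G B).β v = (∑ t : Block G, if h : v ∈ t.1 then (B t).β ⟨v, h⟩ else 0)
      - ((blockIndex G v : ℝ) - 1) := by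
    simp only [composition]
    congr!
  rw [h', h, sub_sub_eq_add_sub, add_comm, add_sub_assoc, ← Finset.sum_sub_distrib]
  congr 1
  refine Finset.sum_congr rfl fun t _ => ?_
  split_ifs <;> simp

theorem composition_α (B : ∀ t : Block G, LapData t.1) (v : V) : (composition G B).α v
    = 1 + ∑ t : Block G, if h : v ∈ t.1 then (B t).α ⟨v, h⟩ - 1 else 0 :=
  -- The two composition rules agree, so `α` is placed in the slot of `β`.
  composition_β (fun t => ⟨0, 0, (B t).α, 0⟩) v

theorem composition_L (B : ∀ t : Block G, LapData t.1) (u v : V) : (composition G B).L u v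
    = ∑ t : Block G, if hv : v ∈ t.1 then if hu : u ∈ t.1 then (B t).L ⟨u, hu⟩ ⟨v, hv⟩ else 0
      else 0 := by
  simp only [composition, Matrix.sum_apply, Matrix.of_apply]
  refine Finset.sum_congr rfl fun t _ => ?_
  by_cases hu : u ∈ t.1 <;> by_cases hv : v ∈ t.1 <;> simp [hu, hv]

theorem sum_mul_composition_L (B : ∀ t : Block G, LapData t.1) (g : V → ℝ) (y : V) :
    ∑ z, g z * (composition G B).L z y
      = ∑ t : Block G, if hy : y ∈ t.1 then ∑ z : t.1, g z * (B t).L z ⟨y, hy⟩ else 0 := by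
  simp only [composition_L, Finset.mul_sum]
  rw [Finset.sum_comm]
  refine Finset.sum_congr rfl fun t _ => ?_
  split_ifs with hy
  · rw [← sum_dite_mem t.1 fun z => g z * (B t).L z ⟨y, hy⟩]
    refine Finset.sum_congr rfl fun z _ => ?_
    split_ifs <;> simp
  · simp

variable {gate : Block G → V → V}

/-- For `x ≠ y`, `exists_isGate_ne` provides a block containing `y` with gate other than `y`, and
`eq_of_isGate_ne` shows that it is unique. For `x = y` the gate is always `y`. -/
theorem sum_gate_ne (hH : G.toSimpleGraphInclusive.Connected)
    (hgate : ∀ t x, IsGate G.toSimpleGraphInclusive t.1 x (gate t x)) (x y : V) :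
    ∑ t : Block G, (if y ∈ t.1 then if gate t x = y then 0 else 1 else 0 : ℝ)
      = if x = y then 0 else 1 := by
  split_ifs with hxy
  · subst hxy
    refine Finset.sum_eq_zero fun t _ => ?_
    split_ifs with h1 h2
    · rfl
    · exact absurd ((hgate t x).eq_of_mem h1) h2
    · rfl
  · obtain ⟨S, hS, hyS, hne⟩ := exists_isGate_ne hH hxy
    rw [Finset.sum_eq_single (⟨S, isBlock_iff.2 hS⟩ : Block G)]
    · rw [if_pos hyS, if_neg (hne _ (hgate ⟨S, isBlock_iff.2 hS⟩ x))]
    · intro t _ ht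
      split_ifs with h1 h2
      · rfl
      · refine absurd (Subtype.ext ?_) ht
        exact eq_of_isGate_ne (isBlock_iff.1 t.2) hS (fun z => ⟨_, hgate t z⟩) h1 hyS
          (hgate t x) (hgate ⟨S, isBlock_iff.2 hS⟩ x) h2 (hne _ (hgate ⟨S, isBlock_iff.2 hS⟩ x))
      · rfl
    · simp

/-- Summation over all blocks, each block without the gate seen from `x`, is summation over all
vertices different from `x`. -/
theorem sum_sum_block (hH : G.toSimpleGraphInclusive.Connected)
    (hgate : ∀ t x, IsGate G.toSimpleGraphInclusive t.1 x (gate t x)) (x : V) (g : V → ℝ) :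
    ∑ t : Block G, (∑ z : t.1, g z - g (gate t x)) = ∑ z, g z - g x := by
  have h1 : ∀ t : Block G, ∑ z : t.1, g z - g (gate t x)
      = ∑ z, g z * (if z ∈ t.1 then if gate t x = z then 0 else 1 else 0) := by
    intro t
    rw [sub_eq_iff_eq_add, ← sum_dite_mem t.1 fun z => g z,
      ← Finset.sum_ite_eq Finset.univ (gate t x) g |>.trans (if_pos (Finset.mem_univ _)),
      ← Finset.sum_add_distrib]
    refine Finset.sum_congr rfl fun z _ => ?_
    split_ifs with h2 h3 h3
    · simp
    · simp
    · exact absurd (h3 ▸ (hgate t x).mem) h2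
    · simp
  simp only [h1]
  rw [Finset.sum_comm]
  simp only [← Finset.mul_sum, sum_gate_ne hH hgate]
  rw [eq_sub_iff_add_eq, ← Finset.sum_ite_eq Finset.univ x g |>.trans (if_pos (Finset.mem_univ _)),
    ← Finset.sum_add_distrib]
  refine Finset.sum_congr rfl fun z _ => ?_
  split_ifs <;> simp

/-- `x` serves as a root, and `sum_sum_block` removes the corrections by `1`. With `g` the row of
`x` in `D`, each block will contribute its `λ_t`. -/
theorem sum_mul_composition_β (hH : G.toSimpleGraphInclusive.Connected)
    (hgate : ∀ t x, IsGate G.toSimpleGraphInclusive t.1 x (gate t x))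
    (B : ∀ t : Block G, LapData t.1) (x : V) (g : V → ℝ) :
    ∑ z, g z * (composition G B).β z
      = g x + ∑ t : Block G, (∑ z : t.1, g z * (B t).β z - g (gate t x)) := by
  have h1 := sum_sum_block hH hgate x g
  have h2 : ∑ z, ∑ t : Block G, g z * (if h : z ∈ t.1 then (B t).β ⟨z, h⟩ - 1 else 0)
      = ∑ t : Block G, ∑ z : t.1, g z * ((B t).β z - 1) := by
    rw [Finset.sum_comm]
    refine Finset.sum_congr rfl fun t _ => ?_
    rw [← sum_dite_mem t.1 fun z => g z * ((B t).β z - 1)]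
    refine Finset.sum_congr rfl fun z _ => ?_
    split_ifs <;> simp
  simp only [composition_β, mul_add, mul_one, Finset.mul_sum, Finset.sum_add_distrib]
  rw [h2]
  simp only [mul_sub, mul_one, Finset.sum_sub_distrib] at h1 ⊢
  linarith

theorem composition_isLapExpressible [Nonempty V] {W : V → V → ℝ}
    (hsc : ∀ x y, ∃ l, IsDirectedPath G x y l) (B : ∀ t : Block G, LapData t.1)
    (hB : ∀ t, IsLapExpressible (blockDistMatrix G W t) (B t)) :
    IsLapExpressible (distMatrix G W) (composition G B) := by
  have hH := connected_of_exists_isDirectedPath hsc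
  choose gate hgate using fun (t : Block G) x => exists_isGate hH (isBlock_iff.1 t.2) x
  have hdist : ∀ (t : Block G) x (z : t.1), distMatrix G W x z
      = distMatrix G W x (gate t x) + blockDistMatrix G W t ⟨_, (hgate t x).mem⟩ z := by
    intro t x z
    rw [distMatrix_eq_add_of_isGate hsc (fun z => ⟨_, hgate t z⟩) (hgate t x) z.2]
    congr 1
    exact distMatrix_eq_block (fun z => ⟨_, hgate t z⟩) ⟨_, (hgate t x).mem⟩ z
  refine ⟨?_, fun x => ?_, fun x y => ?_, fun x => ?_, fun y => ?_⟩
  · have h := sum_mul_composition_β hH hgate B (Classical.arbitrary V) fun _ => 1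
    simp only [one_mul, (hB _).sum_β, sub_self, Finset.sum_const_zero, add_zero] at h
    exact h
  · rw [sum_mul_composition_β hH hgate B x, distMatrix_self, zero_add]
    refine Finset.sum_congr rfl fun t _ => ?_
    simp only [hdist t x, add_mul, Finset.sum_add_distrib, ← Finset.mul_sum, (hB t).sum_β,
      (hB t).sum_mul_β]
    ring
  · rw [sum_mul_composition_L, composition_α]
    have h1 := sum_gate_ne hH hgate x y
    -- The constant distance to the gate is killed by the column sums of `𝓛_t`. What remains is
    -- `α_t(y)` minus the indicator of `gate t x = y`, that is `α_t(y) - 1` plus the indicator of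
    -- `gate t x ≠ y`; the latter are counted by `sum_gate_ne`.
    have h2 : ∀ t : Block G, (if hy : y ∈ t.1 then
        ∑ z : t.1, distMatrix G W x z * (B t).L z ⟨y, hy⟩ else 0)
        = (if h : y ∈ t.1 then (B t).α ⟨y, h⟩ - 1 else 0)
          + (if y ∈ t.1 then if gate t x = y then 0 else 1 else 0) := by
      intro t
      by_cases hy : y ∈ t.1
      · simp only [hy, dif_pos, if_pos, hdist t x, add_mul, Finset.sum_add_distrib,
          ← Finset.mul_sum, (hB t).col_sum, (hB t).sum_mul_L, Subtype.mk.injEq]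
        split_ifs <;> ring
      · simp [hy]
    simp only [h2, Finset.sum_add_distrib]
    rw [h1]
    split_ifs <;> ring
  · simp only [composition_L]
    rw [Finset.sum_comm]
    refine Finset.sum_eq_zero fun t _ => ?_
    rw [sum_dite_mem t.1 fun y => if hu : x ∈ t.1 then (B t).L ⟨x, hu⟩ y else 0]
    split_ifs with hx
    · exact (hB t).row_sum ⟨x, hx⟩
    · simp
  · have h := sum_mul_composition_L B (fun _ => 1) y
    simp only [one_mul, (hB _).col_sum, dite_eq_ite, ite_self, Finset.sum_const_zero] at h
    exact h

end Composition

end CactoidType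

/-! ### Main theorem -/

theorem mainTheorem5 {V : Type*} [Fintype V] [DecidableEq V] (G : Digraph V)
    (hG : CactoidType.IsCactoidType G) (W : V → V → ℝ)
    (hD : (CactoidType.distMatrix G W).det ≠ 0)
    (hDt : ∀ t : CactoidType.Block G, (CactoidType.blockDistMatrix G W t).det ≠ 0)
    (hcof : ∀ t : CactoidType.Block G,
      CactoidType.cof (CactoidType.blockDistMatrix G W t) ≠ 0) :
    (∀ t : CactoidType.Block G,
      ∃ P : CactoidType.DCPresentation (CactoidType.induce G t.1),
        P.IsOrdered (fun x y => W x y)) ∧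
    ∀ P : (t : CactoidType.Block G) → CactoidType.DCPresentation (CactoidType.induce G t.1),
      (∀ t, (P t).IsOrdered (fun x y => W x y)) →
      ∃ (𝓛 : Matrix V V ℝ) (α β : V → ℝ) (lam : ℝ),
        CactoidType.composition G (fun t => (P t).lapData (fun x y => W x y))
          = ⟨lam, α, β, 𝓛⟩ ∧
        (∀ t, ((P t).lapData (fun x y => W x y)).lam =
          (CactoidType.blockDistMatrix G W t).det /
            CactoidType.cof (CactoidType.blockDistMatrix G W t)) ∧
        CactoidType.IsLaplacianLike 𝓛 ∧
        lam ≠ 0 ∧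
        (CactoidType.distMatrix G W)⁻¹ = -𝓛 + (1 / lam) • Matrix.vecMulVec β α := by
  have hsc : ∀ x y, ∃ l, CactoidType.IsDirectedPath G x y l :=
    fun x y => CactoidType.exists_isDirectedPath (hG.1.2 x y)
  have := hG.1.1
  refine ⟨fun t => ?_, fun P hP => ?_⟩
  · obtain ⟨P⟩ := hG.2 t
    exact P.exists_isOrdered _
  have hH := CactoidType.connected_of_exists_isDirectedPath hsc
  have hB : ∀ t : CactoidType.Block G, CactoidType.IsLapExpressible
      (CactoidType.blockDistMatrix G W t) ((P t).lapData fun x y => W x y) := fun t =>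
    (P t).isLapExpressible _ (CactoidType.exists_isDirectedPath_induce hsc
      (CactoidType.exists_isGate hH (CactoidType.isBlock_iff.1 t.2))) (hDt t) (hcof t) (hP t)
  have h := CactoidType.composition_isLapExpressible hsc _ hB
  exact ⟨_, _, _, _, rfl, fun t => eq_div_of_mul_eq (hcof t) (hB t).det_eq.symm,
    h.isLaplacianLike, h.lam_ne_zero hD, h.inv_eq hD⟩
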